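/- Let $n,d\ge 1$ be integers, $\mu>0$ and $\alpha\in\mathbb{R}$. Write $\mathcal{O}(d)$ for the group of orthogonal $d\times d$ real matrices, and $\mathcal{O}(d)^{\otimes n}$ for the set of $G=[G_1;\dots;G_n]\in\mathbb{R}^{nd\times d}$ all of whose $d\times d$ blocks $G_i$ lie in $\mathcal{O}(d)$. Let $\|\cdot\|_F$ be the Frobenius norm, $\|\cdot\|$ the operator norm, $\|X\|_\infty:=\max_{i}\|X_i\|$ for $X\in\mathbb{R}^{nd\times d}$, $1_m\in\mathbb R^m$ the all-ones vector, $\circ$ the Hadamard product and $\otimes$ the Kronecker product. For $X,Y\in\mathbb{R}^{nd\times d}$ put $\mathrm{d}(X,Y):=\min_{g\in\mathcal{O}(d)}\|X-Yg\|_F$. For $Z\in\mathbb{R}^{d\times d}$ let $\Pi_{\mathcal{O}(d)}(Z):=\arg\min_{X\in\mathcal{O}(d)}\|X-Z\|_F$ (a set), and let $\Pi_{\mathcal{O}(d)^{\otimes n}}(X)$ be the set of all $Y\in\mathbb{R}^{nd\times d}$ with $Y_i\in\Pi_{\mathcal{O}(d)}(X_i)$ for every $i$. There are constants $a>0$ and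 $\lambda\in(0,1)$, depending only on $n,d,\mu,\alpha$, such that the following holds. Let $W\in\mathbb{R}^{n\times n}$ be symmetric with $W_{ii}=\mu$ for all $i$ (the possibly weighted adjacency matrix of the measurement graph), $A:=W\otimes(1_d1_d^\top)$, $G^\star\in\mathcal{O}(d)^{\otimes n}$, and let $\Delta\in\mathbb{R}^{nd\times nd}$ be symmetric with zero diagonal $d\times d$ blocks. Put $C:=A\circ(G^\star G^{\star\top}+\Delta)$ and $f(G):=\mathrm{tr}(G^\top CG)$, and let $\hat G$ be any global maximizer of $f$ over $\mathcal{O}(d)^{\otimes n}$. Suppose that (i) $\|W-\mu 1_n1_n^\top\|+\|A\circ\Delta\|\le \dfrac{n^{3/4}\mu}{60\,d^{1/2}}$ and $\|(A\circ\Delta)G^\star\|_\infty\le \dfrac{n\mu}{10}$; (ii) $\max_{1\le i\le n}\big\|\big((A-\mu 1_{nd}1_{nd}^\top)\circ G^\star G^{\star\top}\big)_i^\top\hat G\big\|\le \dfrac{n\mu}{10}$, where $M_i\in\mathbb{R}^{nd\times d}$ denotes the $i$-th block column of $M\in\mathbb{R}^{nd\times nd}$; (iii) $\|A\circ\Delta\|+\|W-\mu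 1_n1_n^\top\|<\alpha\le \dfrac{n\mu}{30\sqrt{2d}}$. Let $(G^k)_{k\ge0}$ be any sequence generated by the generalized power method: $G^0\in\Pi_{\mathcal{O}(d)^{\otimes n}}(\Phi)$, where the columns of $\Phi\in\mathbb{R}^{nd\times d}$ are eigenvectors of $C$ belonging to its $d$ largest eigenvalues (counted with multiplicity) and $\Phi^\top\Phi=nI_d$, and $G^{k+1}\in\Pi_{\mathcal{O}(d)^{\otimes n}}\big((C+\alpha I_{nd})G^k\big)$ for $k\ge0$. Then for every $k\ge0$ $$f(\hat G)-f(G^k)\le\big(f(\hat G)-f(G^0)\big)\lambda^k\qquad\text{and}\qquad \mathrm{d}(G^k,\hat G)\le a\,\big(f(\hat G)-f(G^0)\big)^{1/2}\lambda^{k/2}.$$ -/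

import Mathlib

open scoped Matrix Kronecker

namespace OrthSync

noncomputable section

/-- `ℝ^{nd × d}`, rows grouped in `n` blocks of size `d`. -/
abbrev BlockVec (n d : ℕ) := Matrix (Fin n × Fin d) (Fin d) ℝ

/-- `ℝ^{nd × nd}`, rows and columns grouped in `n` blocks of size `d`. -/
abbrev BlockMat (n d : ℕ) := Matrix (Fin n × Fin d) (Fin n × Fin d) ℝ

/-- The Frobenius norm, induced by `⟨X, Y⟩ = tr (Xᵀ Y)`. -/
def frobNorm {m k : Type*} [Fintype m] [Fintype k] (X : Matrix m k ℝ) : ℝ :=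
  Real.sqrt (Matrix.trace (Xᵀ * X))

/-- The operator (spectral) norm of a square matrix acting on Euclidean space. -/
def opNorm {m : Type*} [Fintype m] [DecidableEq m] (X : Matrix m m ℝ) : ℝ :=
  ‖Matrix.toEuclideanCLM (𝕜 := ℝ) X‖

/-- The `i`-th `d × d` block `X_i` of `X ∈ ℝ^{nd × d}`. -/
def block {n d : ℕ} (X : BlockVec n d) (i : Fin n) : Matrix (Fin d) (Fin d) ℝ :=
  Matrix.of fun a b => X (i, a) b

/-- The `i`-th block column `X_i ∈ ℝ^{nd × d}` of `X ∈ ℝ^{nd × nd}`. -/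
def blockCol {n d : ℕ} (X : BlockMat n d) (i : Fin n) : BlockVec n d :=
  Matrix.of fun p b => X p (i, b)

/-- `‖X‖_∞ = max_i ‖X_i‖` for `X ∈ ℝ^{nd × d}`. -/
def blockInfNorm {n d : ℕ} (X : BlockVec n d) : ℝ :=
  ⨆ i : Fin n, opNorm (block X i)

/-- The orthogonal group `O(d)` as a set of matrices. -/
def orthGroup (d : ℕ) : Set (Matrix (Fin d) (Fin d) ℝ) :=
  {g | gᵀ * g = 1 ∧ g * gᵀ = 1}

/-- `O(d)^{⊗ n}`: all blocks are orthogonal. -/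
def orthProd (n d : ℕ) : Set (BlockVec n d) :=
  {G | ∀ i, block G i ∈ orthGroup d}

/-- The multivalued Frobenius projection onto a set of matrices. -/
def proj {m k : Type*} [Fintype m] [Fintype k] (Z : Set (Matrix m k ℝ)) (X : Matrix m k ℝ) :
    Set (Matrix m k ℝ) :=
  {Y | Y ∈ Z ∧ ∀ Y' ∈ Z, frobNorm (X - Y) ≤ frobNorm (X - Y')}

/-- The multivalued projection onto `O(d)^{⊗ n}`, taken block by block. -/
def projOrthProd {n d : ℕ} (X : BlockVec n d) : Set (BlockVec n d) :=
  {Y | ∀ i, block Y i ∈ proj (orthGroup d) (block X i)}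

/-- `d(X, Y) = min_{g ∈ O(d)} ‖X - Y g‖_F`. -/
def phaseDist {n d : ℕ} (X Y : BlockVec n d) : ℝ :=
  ⨅ g : orthGroup d, frobNorm (X - Y * (g : Matrix (Fin d) (Fin d) ℝ))

/-- The all-ones square matrix. -/
def ones (m : Type*) : Matrix m m ℝ := Matrix.of fun _ _ => 1

/-- `A = W ⊗ (1_d 1_dᵀ)`. -/
def adjBlock {n : ℕ} (d : ℕ) (W : Matrix (Fin n) (Fin n) ℝ) : BlockMat n d :=
  W ⊗ₖ ones (Fin d)

/-- The measurement matrix `C = A ∘ (G⋆ G⋆ᵀ + Δ)`. -/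
def measurement {n d : ℕ} (W : Matrix (Fin n) (Fin n) ℝ) (Gstar : BlockVec n d)
    (Δ : BlockMat n d) : BlockMat n d :=
  adjBlock d W ⊙ (Gstar * Gstarᵀ + Δ)

/-- The noise is symmetric with vanishing diagonal blocks. -/
def IsNoise {n d : ℕ} (Δ : BlockMat n d) : Prop :=
  Δ.IsSymm ∧ ∀ (i : Fin n) (a b : Fin d), Δ (i, a) (i, b) = 0

/-- `f(G) = tr (Gᵀ C G)`. -/
def objective {n d : ℕ} (C : BlockMat n d) (G : BlockVec n d) : ℝ :=
  Matrix.trace (Gᵀ * C * G)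

/-- `G` is a global maximizer of `f` over `O(d)^{⊗ n}`. -/
def IsGlobalMaximizer {n d : ℕ} (C : BlockMat n d) (G : BlockVec n d) : Prop :=
  G ∈ orthProd n d ∧ ∀ G' ∈ orthProd n d, objective C G' ≤ objective C G

/-- The columns of `Φ` are top `d` eigenvectors of the symmetric matrix `C`, scaled so that
`Φᵀ Φ = n I_d`: each column is an eigenvector, and every eigenvector orthogonal to all the
columns belongs to an eigenvalue that is at most each of the `d` eigenvalues selected. -/
def IsTopEigenvectors {n d : ℕ} (C : BlockMat n d) (Φ : BlockVec n d) : Prop :=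
  Φᵀ * Φ = (n : ℝ) • (1 : Matrix (Fin d) (Fin d) ℝ) ∧
  ∃ ev : Fin d → ℝ,
    (∀ j, C *ᵥ (fun p => Φ p j) = ev j • (fun p => Φ p j)) ∧
    ∀ (x : Fin n × Fin d → ℝ) (t : ℝ), x ≠ 0 → (∀ j, (fun p => Φ p j) ⬝ᵥ x = 0) →
      C *ᵥ x = t • x → ∀ j, t ≤ ev j

/-- `(G k)` is a run of the generalized power method for `C` with stepsize `α`: `G 0` is a
projection of scaled top eigenvectors, and `G (k+1) ∈ Π((C + α I) G k)`; every choice in the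
multivalued projections and in the eigenvectors is allowed. -/
def IsGPMRun {n d : ℕ} (C : BlockMat n d) (α : ℝ) (G : ℕ → BlockVec n d) : Prop :=
  (∃ Φ : BlockVec n d, IsTopEigenvectors C Φ ∧ G 0 ∈ projOrthProd Φ) ∧
  ∀ k, G (k + 1) ∈ projOrthProd ((C + α • (1 : BlockMat n d)) * G k)

end

end OrthSync

open OrthSync

/-! Write `C = μ H Hᵀ + R` with `H = Gstar` and `R` of operator norm at most `η`, the left side of
(i). For `G` rotated into alignment with `H`, the low-rank part makes the gap `f(H) - f(G)`
comparable to `nμ‖G - H‖²`, up to an error linear in `‖G - H‖` of scale `e = n^{1/4}/15`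
(`gap_bounds`). Hence any `G` with `GᵀG = nI` and `f(G) ≥ f(H)` is within `e` of `H` up to rotation.
This covers the maximizer `Y` and, by Ky Fan, the eigenvector matrix `Φ`, so `f(H) - f(G 0) ≤
5nμe²`. The shift `α ≥ η` makes `C + αI` positive semidefinite, so `f` never decreases along the
run. The sublevel set of the gap, rather than a ball, is therefore the invariant basin, and every
iterate stays within `5e` of a rotation of `Y`.

Near `Y` the gap is `s - q`, where `s` is the quadratic form of the block multipliers `(CY)ᵢ Yᵢᵀ`
and `q` that of `C`, both at `X = G - Y`. Conditions (i) and (ii) give multipliers at least `0.79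
nμ` (`posSemidef_multiplier_sub`), while alignment makes `HᵀX` small and `|q| ≤ (3/40) nμ‖X‖²`
(`abs_quadratic_le`). One step gains at least `s - 2q - α‖X‖²`, more than half the gap
(`contraction`), so `λ = 1/2`. -/

namespace OrthSync

/-! ### Frobenius inner product and norm. -/

section Frobenius

open scoped Matrix.Norms.Frobenius

variable {m k l : Type*} [Fintype m] [Fintype k] [Fintype l]

theorem trace_transpose_mul (X Y : Matrix m k ℝ) :
    Matrix.trace (Xᵀ * Y) = ∑ i, ∑ j, X i j * Y i j := by
  simp only [Matrix.trace, Matrix.diag, Matrix.mul_apply, Matrix.transpose_apply]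
  exact Finset.sum_comm

theorem trace_transpose_mul_comm (X Y : Matrix m k ℝ) :
    Matrix.trace (Xᵀ * Y) = Matrix.trace (Yᵀ * X) := by
  rw [← Matrix.trace_transpose, Matrix.transpose_mul, Matrix.transpose_transpose]

theorem norm_sq_eq_sum (X : Matrix m k ℝ) : ‖X‖ ^ 2 = ∑ i, ∑ j, X i j ^ 2 := by
  rw [Matrix.frobenius_norm_def, ← Real.sqrt_eq_rpow, Real.sq_sqrt (by positivity)]
  simp

theorem trace_transpose_mul_self (X : Matrix m k ℝ) : Matrix.trace (Xᵀ * X) = ‖X‖ ^ 2 := by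
  rw [trace_transpose_mul, norm_sq_eq_sum]
  simp [sq]

theorem frobNorm_eq_norm (X : Matrix m k ℝ) : frobNorm X = ‖X‖ := by
  rw [frobNorm, trace_transpose_mul_self, Real.sqrt_sq (norm_nonneg _)]

theorem abs_trace_transpose_mul_le (X Y : Matrix m k ℝ) :
    |Matrix.trace (Xᵀ * Y)| ≤ ‖X‖ * ‖Y‖ := by
  refine abs_le_of_sq_le_sq ?_ (by positivity)
  rw [trace_transpose_mul, mul_pow, norm_sq_eq_sum, norm_sq_eq_sum]
  simp only [← Finset.sum_product']
  exact Finset.sum_mul_sq_le_sq_mul_sq _ _ _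

theorem norm_sub_sq (X Y : Matrix m k ℝ) :
    ‖X - Y‖ ^ 2 = ‖X‖ ^ 2 - 2 * Matrix.trace (Xᵀ * Y) + ‖Y‖ ^ 2 := by
  simp only [← trace_transpose_mul_self, Matrix.transpose_sub, Matrix.sub_mul, Matrix.mul_sub,
    Matrix.trace_sub]
  rw [trace_transpose_mul_comm Y X]
  ring

theorem norm_mul_le_opNorm [DecidableEq m] (R : Matrix m m ℝ) (Y : Matrix m k ℝ) :
    ‖R * Y‖ ≤ opNorm R * ‖Y‖ := by
  have h0 : 0 ≤ opNorm R := norm_nonneg _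
  refine abs_le_of_sq_le_sq' ?_ (by positivity) |>.2
  rw [mul_pow, norm_sq_eq_sum, norm_sq_eq_sum, Finset.sum_comm, Finset.sum_comm (s := .univ (α := m)),
    Finset.mul_sum]
  refine Finset.sum_le_sum fun j _ => ?_
  have h := (Matrix.toEuclideanCLM (𝕜 := ℝ) R).le_opNorm (WithLp.toLp 2 fun i => Y i j)
  have h2 := pow_le_pow_left₀ (norm_nonneg _) h 2
  rw [mul_pow, EuclideanSpace.norm_sq_eq, EuclideanSpace.norm_sq_eq] at h2
  simpa [Matrix.mul_apply, Matrix.mulVec, dotProduct, opNorm] using h2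

theorem abs_trace_le_opNorm [DecidableEq m] (R : Matrix m m ℝ) (X Y : Matrix m k ℝ) :
    |Matrix.trace (Xᵀ * (R * Y))| ≤ opNorm R * ‖X‖ * ‖Y‖ := by
  refine (abs_trace_transpose_mul_le _ _).trans ?_
  have := mul_le_mul_of_nonneg_left (norm_mul_le_opNorm R Y) (norm_nonneg X)
  linarith

theorem norm_mul_of_transpose_mul_self [DecidableEq m] {g : Matrix l m ℝ} (hg : gᵀ * g = 1)
    (X : Matrix m k ℝ) : ‖g * X‖ = ‖X‖ := by
  rw [← sq_eq_sq₀ (norm_nonneg _) (norm_nonneg _), ← trace_transpose_mul_self,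
    ← trace_transpose_mul_self, Matrix.transpose_mul, Matrix.mul_assoc, ← Matrix.mul_assoc gᵀ, hg,
    Matrix.one_mul]

theorem norm_mul_of_mul_transpose_self [DecidableEq k] {g : Matrix k l ℝ} (hg : g * gᵀ = 1)
    (X : Matrix m k ℝ) : ‖X * g‖ = ‖X‖ := by
  rw [← Matrix.frobenius_norm_transpose, Matrix.transpose_mul,
    norm_mul_of_transpose_mul_self (by simpa using hg), Matrix.frobenius_norm_transpose]

end Frobenius

/-! ### Reflections and positivity of polar factors. -/

section OrthGroup

variable {d : ℕ} {g h : Matrix (Fin d) (Fin d) ℝ}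

theorem one_mem_orthGroup : (1 : Matrix (Fin d) (Fin d) ℝ) ∈ orthGroup d := by
  simp [orthGroup]

theorem transpose_mem_orthGroup (hg : g ∈ orthGroup d) : gᵀ ∈ orthGroup d := by
  simpa [orthGroup] using hg.symm

theorem mul_mem_orthGroup (hg : g ∈ orthGroup d) (hh : h ∈ orthGroup d) : g * h ∈ orthGroup d := by
  constructor
  · rw [Matrix.transpose_mul, Matrix.mul_assoc, ← Matrix.mul_assoc gᵀ, hg.1, Matrix.one_mul, hh.1]
  · rw [Matrix.transpose_mul, Matrix.mul_assoc, ← Matrix.mul_assoc h, hh.2, Matrix.one_mul, hg.2]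

/-- The reflection along `u`. -/
noncomputable def reflection (u : Fin d → ℝ) : Matrix (Fin d) (Fin d) ℝ :=
  1 - (2 / (u ⬝ᵥ u)) • Matrix.vecMulVec u u

theorem reflection_mem_orthGroup {u : Fin d → ℝ} (hu : u ⬝ᵥ u ≠ 0) :
    reflection u ∈ orthGroup d := by
  have hs : (reflection u)ᵀ = reflection u := by
    simp [reflection, Matrix.transpose_sub, Matrix.transpose_vecMulVec]
  have hm : reflection u * reflection u = 1 := by
    simp only [reflection, Matrix.sub_mul, Matrix.mul_sub, Matrix.one_mul, Matrix.mul_one,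
      Matrix.smul_mul, Matrix.mul_smul, Matrix.vecMulVec_mul_vecMulVec]
    ext i j
    simp [Matrix.vecMulVec_apply]
    field_simp
    ring
  exact ⟨by rw [hs, hm], by rw [hs, hm]⟩

theorem trace_vecMulVec_mul (u v : Fin d → ℝ) (N : Matrix (Fin d) (Fin d) ℝ) :
    Matrix.trace (Matrix.vecMulVec u v * N) = v ⬝ᵥ (N *ᵥ u) := by
  rw [Matrix.vecMulVec_mul, Matrix.trace_vecMulVec, dotProduct_comm, Matrix.dotProduct_mulVec]

/-- If `1` maximizes `Y ↦ tr (Y N)` over the orthogonal group, then `N` is positive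
semidefinite. -/
theorem posSemidef_of_trace_mul_le {N : Matrix (Fin d) (Fin d) ℝ}
    (h : ∀ Y ∈ orthGroup d, Matrix.trace (Y * N) ≤ Matrix.trace N) : N.PosSemidef := by
  -- One reflection lowers the trace by `2 uᵀNu / uᵀu`, which gives positivity of the form but not
  -- symmetry of `N`.
  have hnn : ∀ u : Fin d → ℝ, 0 ≤ u ⬝ᵥ (N *ᵥ u) := by
    intro u
    by_cases hu : u ⬝ᵥ u = 0
    · simp [dotProduct_self_eq_zero.mp hu]
    have h1 := h _ (reflection_mem_orthGroup hu)
    have hp : 0 < u ⬝ᵥ u := lt_of_le_of_ne (dotProduct_self_star_nonneg u) (Ne.symm hu)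
    rw [reflection, Matrix.sub_mul, Matrix.trace_sub, Matrix.one_mul, Matrix.smul_mul,
      Matrix.trace_smul, trace_vecMulVec_mul, smul_eq_mul] at h1
    have h2 : 0 ≤ 2 / (u ⬝ᵥ u) * u ⬝ᵥ (N *ᵥ u) := by linarith
    exact nonneg_of_mul_nonneg_right h2 (by positivity)
  have htwo : ∀ u v : Fin d → ℝ, u ⬝ᵥ u ≠ 0 → v ⬝ᵥ v ≠ 0 →
      2 * (u ⬝ᵥ v) * (v ⬝ᵥ (N *ᵥ u)) ≤
        (v ⬝ᵥ v) * (u ⬝ᵥ (N *ᵥ u)) + (u ⬝ᵥ u) * (v ⬝ᵥ (N *ᵥ v)) := by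
    intro u v hu hv
    have h1 := h _ (mul_mem_orthGroup (reflection_mem_orthGroup hu) (reflection_mem_orthGroup hv))
    have hp : 0 < u ⬝ᵥ u := lt_of_le_of_ne (dotProduct_self_star_nonneg u) (Ne.symm hu)
    have hq : 0 < v ⬝ᵥ v := lt_of_le_of_ne (dotProduct_self_star_nonneg v) (Ne.symm hv)
    simp only [reflection, Matrix.sub_mul, Matrix.mul_sub, Matrix.one_mul, Matrix.mul_one,
      Matrix.smul_mul, Matrix.mul_smul, Matrix.vecMulVec_mul_vecMulVec, Matrix.trace_sub,
      Matrix.trace_smul, Matrix.vecMulVec_smul, trace_vecMulVec_mul, smul_eq_mul] at h1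
    have h2 : 0 ≤ (u ⬝ᵥ u) * (v ⬝ᵥ v) / 2 * ((2 / (u ⬝ᵥ u)) * (u ⬝ᵥ (N *ᵥ u))
        + (2 / (v ⬝ᵥ v)) * (v ⬝ᵥ (N *ᵥ v))
        - (2 / (u ⬝ᵥ u)) * ((2 / (v ⬝ᵥ v)) * ((u ⬝ᵥ v) * (v ⬝ᵥ (N *ᵥ u))))) := by
      apply mul_nonneg (by positivity)
      linarith
    have h3 : (u ⬝ᵥ u) * (v ⬝ᵥ v) / 2 * ((2 / (u ⬝ᵥ u)) * (u ⬝ᵥ (N *ᵥ u))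
        + (2 / (v ⬝ᵥ v)) * (v ⬝ᵥ (N *ᵥ v))
        - (2 / (u ⬝ᵥ u)) * ((2 / (v ⬝ᵥ v)) * ((u ⬝ᵥ v) * (v ⬝ᵥ (N *ᵥ u))))) =
        (v ⬝ᵥ v) * (u ⬝ᵥ (N *ᵥ u)) + (u ⬝ᵥ u) * (v ⬝ᵥ (N *ᵥ v))
          - 2 * (u ⬝ᵥ v) * (v ⬝ᵥ (N *ᵥ u)) := by
      field_simp
    linarith
  -- Products of two reflections detect the antisymmetric part: for `u = eᵢ`, `v = eᵢ + t eⱼ` it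
  -- enters linearly in `t`, against a bound quadratic in `t`.
  have hsymm : ∀ i j, N i j = N j i := by
    intro i j
    by_cases hij : i = j
    · rw [hij]
    have key : ∀ t : ℝ, t * (N j i - N i j) ≤ t ^ 2 * (N i i + N j j) := by
      intro t
      have hji : j ≠ i := fun h => hij h.symm
      have hvv : (Pi.single i 1 + t • Pi.single j 1 : Fin d → ℝ) ⬝ᵥ
          (Pi.single i 1 + t • Pi.single j 1) = 1 + t ^ 2 := by
        simp [hij, hji]
        ring
      have := htwo (Pi.single i 1) (Pi.single i 1 + t • Pi.single j 1) (by simp)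
        (by rw [hvv]; positivity)
      rw [hvv] at this
      simp [hji, Matrix.mulVec_add, Matrix.mulVec_smul] at this
      nlinarith
    by_contra hne
    have hpos : 0 < (N j i - N i j) ^ 2 := by
      have : N j i - N i j ≠ 0 := fun h => hne (by linarith)
      positivity
    set s := N j i - N i j with hs
    set b := |N i i + N j j| + 1
    have hb : 0 < b := by positivity
    have hk := key (s / b)
    have hle : (s / b) ^ 2 * (N i i + N j j) ≤ (s / b) ^ 2 * (b - 1) :=
      mul_le_mul_of_nonneg_left (by simp [b, le_abs_self]) (by positivity)
    have : s / b * s = (s / b) ^ 2 * b := by field_simp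
    have h4 : 0 < (s / b) ^ 2 := by rw [div_pow]; positivity
    nlinarith
  refine Matrix.PosSemidef.of_dotProduct_mulVec_nonneg ?_ (by simpa using hnn)
  ext i j
  simpa using hsymm j i

end OrthGroup

/-! ### Polar factors and overlap of aligned matrices. -/

section Alignment

open scoped Matrix.Norms.Frobenius

variable {d : ℕ}

theorem isCompact_orthGroup (d : ℕ) : IsCompact (orthGroup d) := by
  refine Metric.isCompact_of_isClosed_isBounded ?_ ?_
  · exact (isClosed_eq (by fun_prop) continuous_const).inter
      (isClosed_eq (by fun_prop) continuous_const)
  · refine isBounded_iff_forall_norm_le.mpr ⟨‖(1 : Matrix (Fin d) (Fin d) ℝ)‖, fun g hg => ?_⟩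
    have := norm_mul_of_transpose_mul_self hg.1 (1 : Matrix (Fin d) (Fin d) ℝ)
    rw [Matrix.mul_one] at this
    exact this.le

/-- A maximizer of a linear functional on the orthogonal group is a polar factor. -/
theorem posSemidef_of_maximizes {g M : Matrix (Fin d) (Fin d) ℝ} (hg : g ∈ orthGroup d)
    (h : ∀ Y ∈ orthGroup d, Matrix.trace (Yᵀ * M) ≤ Matrix.trace (gᵀ * M)) :
    (gᵀ * M).PosSemidef := by
  refine posSemidef_of_trace_mul_le fun Y hY => ?_
  have := h (g * Yᵀ) (mul_mem_orthGroup hg (transpose_mem_orthGroup hY))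
  rwa [Matrix.transpose_mul, Matrix.transpose_transpose, Matrix.mul_assoc] at this

theorem exists_polar_factor (M : Matrix (Fin d) (Fin d) ℝ) :
    ∃ g ∈ orthGroup d, (gᵀ * M).PosSemidef ∧
      ∀ Y ∈ orthGroup d, Matrix.trace (Yᵀ * M) ≤ Matrix.trace (gᵀ * M) := by
  obtain ⟨g, hg, hmax⟩ := (isCompact_orthGroup d).exists_isMaxOn ⟨1, one_mem_orthGroup⟩
    (f := fun Y => Matrix.trace (Yᵀ * M)) (by fun_prop)
  exact ⟨g, hg, posSemidef_of_maximizes hg fun Y hY => hmax hY, fun Y hY => hmax hY⟩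

variable {m : Type*} [Fintype m] {c : ℝ} {G H : Matrix m (Fin d) ℝ}

theorem norm_sq_of_gram (hG : Gᵀ * G = c • 1) : ‖G‖ ^ 2 = c * d := by
  rw [← trace_transpose_mul_self, hG]
  simp

theorem transpose_mul_eq_of_posSemidef (hG : Gᵀ * G = c • 1) (hH : Hᵀ * H = c • 1)
    (hP : (Hᵀ * G).PosSemidef) : Hᵀ * G = c • 1 - (1 / 2 : ℝ) • ((G - H)ᵀ * (G - H)) := by
  have hs : Gᵀ * H = Hᵀ * G := by
    have := hP.isHermitian.eq
    simpa using this
  rw [Matrix.transpose_sub, Matrix.sub_mul, Matrix.mul_sub, Matrix.mul_sub, hG, hH, hs]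
  ext i j
  simp
  ring

/-- With `X = G - H` and `P = HᵀG = c - XᵀX/2`, one gets `c²d - ‖P‖² = (c/2)‖X‖² + tr(XᵀXP)/2`, and
`tr(XᵀXP)` lies between `0` (as `P` is positive semidefinite) and `c‖X‖²`. -/
theorem overlap_bounds (hG : Gᵀ * G = c • 1) (hH : Hᵀ * H = c • 1) (hP : (Hᵀ * G).PosSemidef) :
    c / 2 * ‖G - H‖ ^ 2 ≤ c ^ 2 * d - ‖Hᵀ * G‖ ^ 2 ∧
      c ^ 2 * d - ‖Hᵀ * G‖ ^ 2 ≤ c * ‖G - H‖ ^ 2 := by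
  have hE := transpose_mul_eq_of_posSemidef hG hH hP
  have hs : (Hᵀ * G)ᵀ = Hᵀ * G := by simpa using hP.isHermitian.eq
  set X := G - H
  set P := Hᵀ * G
  have htr : Matrix.trace P = c * d - 1 / 2 * ‖X‖ ^ 2 := by
    rw [hE, Matrix.trace_sub, Matrix.trace_smul, Matrix.trace_smul, trace_transpose_mul_self]
    simp
  have hnn : 0 ≤ Matrix.trace (Xᵀ * X * P) := by
    have := (hP.mul_mul_conjTranspose_same X).trace_nonneg
    rwa [Matrix.trace_mul_comm, ← Matrix.mul_assoc, Matrix.conjTranspose_eq_transpose_of_trivial]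
      at this
  have h1 : ‖P‖ ^ 2 = c * Matrix.trace P - 1 / 2 * Matrix.trace (Xᵀ * X * P) := by
    have hPP : P * P = c • P - (1 / 2 : ℝ) • (Xᵀ * X * P) := by
      nth_rewrite 1 [hE]
      rw [Matrix.sub_mul, Matrix.smul_mul, Matrix.smul_mul, Matrix.one_mul]
    rw [← trace_transpose_mul_self, hs, hPP, Matrix.trace_sub, Matrix.trace_smul,
      Matrix.trace_smul, smul_eq_mul, smul_eq_mul]
  have h2 : Matrix.trace (Xᵀ * X * P) = c * ‖X‖ ^ 2 - 1 / 2 * ‖Xᵀ * X‖ ^ 2 := by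
    conv_lhs => rw [hE]
    rw [← trace_transpose_mul_self (Xᵀ * X), Matrix.mul_sub, Matrix.trace_sub, Matrix.mul_smul,
      Matrix.mul_smul, Matrix.trace_smul, Matrix.trace_smul, Matrix.mul_one,
      trace_transpose_mul_self]
    simp
  constructor
  · rw [h1, htr]; nlinarith
  · rw [h1, htr]; nlinarith [sq_nonneg ‖Xᵀ * X‖]

end Alignment

/-! ### The objective for a rank-`d` matrix plus a perturbation. -/

section Objective

open scoped Matrix.Norms.Frobenius

variable {n d : ℕ} {c μ η : ℝ} {G H : BlockVec n d} {R : BlockMat n d}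

theorem objective_mul_orth (C : BlockMat n d) (G : BlockVec n d) {g : Matrix (Fin d) (Fin d) ℝ}
    (hg : g ∈ orthGroup d) : objective C (G * g) = objective C G := by
  rw [objective, Matrix.transpose_mul, Matrix.mul_assoc, Matrix.mul_assoc, Matrix.trace_mul_comm]
  simp only [Matrix.mul_assoc, hg.2, objective, Matrix.mul_one]

theorem objective_lowRank_add (μ : ℝ) (H G : BlockVec n d) (R : BlockMat n d) :
    objective (μ • (H * Hᵀ) + R) G = μ * ‖Hᵀ * G‖ ^ 2 + Matrix.trace (Gᵀ * (R * G)) := by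
  rw [objective, Matrix.mul_add, Matrix.add_mul, Matrix.trace_add, Matrix.mul_smul,
    Matrix.smul_mul, Matrix.trace_smul, ← trace_transpose_mul_self, Matrix.transpose_mul,
    Matrix.transpose_transpose]
  simp only [Matrix.mul_assoc, smul_eq_mul]

/-- Symmetry of `R` factors the difference as `⟨G - H, R(G + H)⟩`. -/
theorem abs_trace_sub_trace_le (hRs : R.IsSymm)
    (hR : ∀ X Y : BlockVec n d, |Matrix.trace (Xᵀ * (R * Y))| ≤ η * ‖X‖ * ‖Y‖)
    (hη : 0 ≤ η) (hG : Gᵀ * G = c • 1) (hH : Hᵀ * H = c • 1) :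
    |Matrix.trace (Gᵀ * (R * G)) - Matrix.trace (Hᵀ * (R * H))| ≤
      2 * √(c * d) * η * ‖G - H‖ := by
  have hx : Matrix.trace (Gᵀ * (R * H)) = Matrix.trace (Hᵀ * (R * G)) := by
    rw [← Matrix.trace_transpose]
    simp only [Matrix.transpose_mul, Matrix.transpose_transpose, hRs.eq, Matrix.mul_assoc]
  have : Matrix.trace (Gᵀ * (R * G)) - Matrix.trace (Hᵀ * (R * H)) =
      Matrix.trace ((G - H)ᵀ * (R * (G + H))) := by
    simp only [Matrix.transpose_sub, Matrix.sub_mul, Matrix.mul_add, Matrix.trace_sub,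
      Matrix.trace_add]
    linarith
  rw [this]
  refine (hR _ _).trans ?_
  have h1 : ‖G‖ = √(c * d) := by
    rw [← norm_sq_of_gram hG, Real.sqrt_sq (norm_nonneg _)]
  have h2 : ‖H‖ = √(c * d) := by
    rw [← norm_sq_of_gram hH, Real.sqrt_sq (norm_nonneg _)]
  have h3 : ‖G + H‖ ≤ 2 * √(c * d) := by
    linarith [norm_add_le G H]
  calc η * ‖G - H‖ * ‖G + H‖ ≤ η * ‖G - H‖ * (2 * √(c * d)) := by gcongr
    _ = _ := by ring

theorem norm_transpose_mul_self_of_gram {m : Type*} [Fintype m] {H : Matrix m (Fin d) ℝ}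
    (hH : Hᵀ * H = c • 1) : ‖Hᵀ * H‖ ^ 2 = c ^ 2 * d := by
  rw [hH, ← trace_transpose_mul_self]
  simp
  ring

/-- Two-sided comparison of the objective gap with the distance of an aligned pair. -/
theorem objective_gap_bounds (hRs : R.IsSymm)
    (hR : ∀ X Y : BlockVec n d, |Matrix.trace (Xᵀ * (R * Y))| ≤ η * ‖X‖ * ‖Y‖)
    (hη : 0 ≤ η) (hμ : 0 ≤ μ) (hG : Gᵀ * G = c • 1) (hH : Hᵀ * H = c • 1)
    (hP : (Hᵀ * G).PosSemidef) :
    μ * (c / 2 * ‖G - H‖ ^ 2) - 2 * √(c * d) * η * ‖G - H‖ ≤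
        objective (μ • (H * Hᵀ) + R) H - objective (μ • (H * Hᵀ) + R) G ∧
      objective (μ • (H * Hᵀ) + R) H - objective (μ • (H * Hᵀ) + R) G ≤
        μ * (c * ‖G - H‖ ^ 2) + 2 * √(c * d) * η * ‖G - H‖ := by
  have h1 := abs_le.mp (abs_trace_sub_trace_le hRs hR hη hG hH)
  obtain ⟨h2, h3⟩ := overlap_bounds hG hH hP
  rw [objective_lowRank_add, objective_lowRank_add, norm_transpose_mul_self_of_gram hH]
  have h4 := mul_le_mul_of_nonneg_left h2 hμ
  have h5 := mul_le_mul_of_nonneg_left h3 hμ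
  constructor <;> linarith

end Objective

/-! ### Block decomposition, optimal rotations and projections. -/

section Blocks

open scoped Matrix.Norms.Frobenius

variable {n d : ℕ}

theorem trace_transpose_mul_eq_sum_block (X Y : BlockVec n d) :
    Matrix.trace (Xᵀ * Y) = ∑ i, Matrix.trace ((block X i)ᵀ * block Y i) := by
  simp only [trace_transpose_mul, Fintype.sum_prod_type, block, Matrix.of_apply]

theorem norm_sq_eq_sum_block (X : BlockVec n d) : ‖X‖ ^ 2 = ∑ i, ‖block X i‖ ^ 2 := by
  simp only [← trace_transpose_mul_self, trace_transpose_mul_eq_sum_block]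

theorem norm_block_le (X : BlockVec n d) (i : Fin n) : ‖block X i‖ ≤ ‖X‖ := by
  refine abs_le_of_sq_le_sq' ?_ (norm_nonneg _) |>.2
  rw [norm_sq_eq_sum_block]
  exact Finset.single_le_sum (f := fun i => ‖block X i‖ ^ 2) (fun _ _ => by positivity)
    (Finset.mem_univ i)

theorem block_mul (X : BlockVec n d) (g : Matrix (Fin d) (Fin d) ℝ) (i : Fin n) :
    block (X * g) i = block X i * g := rfl

theorem block_add (X Y : BlockVec n d) (i : Fin n) :
    block (X + Y) i = block X i + block Y i := rfl

theorem block_smul (r : ℝ) (X : BlockVec n d) (i : Fin n) :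
    block (r • X) i = r • block X i := rfl

theorem gram_of_mem_orthProd {G : BlockVec n d} (hG : G ∈ orthProd n d) :
    Gᵀ * G = (n : ℝ) • 1 := by
  have : Gᵀ * G = ∑ i, (block G i)ᵀ * block G i := by
    ext a b
    simp [Matrix.mul_apply, Fintype.sum_prod_type, Matrix.sum_apply, block]
  rw [this, Finset.sum_congr rfl fun i _ => (hG i).1]
  simp [← Nat.cast_smul_eq_nsmul ℝ]

theorem mul_orth_mem_orthProd {G : BlockVec n d} (hG : G ∈ orthProd n d)
    {g : Matrix (Fin d) (Fin d) ℝ} (hg : g ∈ orthGroup d) : G * g ∈ orthProd n d :=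
  fun i => mul_mem_orthGroup (hG i) hg

theorem gram_mul_orth {m : Type*} [Fintype m] {c : ℝ} {H : Matrix m (Fin d) ℝ}
    (hH : Hᵀ * H = c • 1) {g : Matrix (Fin d) (Fin d) ℝ} (hg : g ∈ orthGroup d) :
    (H * g)ᵀ * (H * g) = c • 1 := by
  rw [Matrix.transpose_mul, Matrix.mul_assoc, ← Matrix.mul_assoc Hᵀ, hH, Matrix.smul_mul,
    Matrix.one_mul, Matrix.mul_smul, hg.1]

theorem mul_orth_mul_transpose {m : Type*} [Fintype m] (H : Matrix m (Fin d) ℝ)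
    {g : Matrix (Fin d) (Fin d) ℝ} (hg : g ∈ orthGroup d) :
    (H * g) * (H * g)ᵀ = H * Hᵀ := by
  rw [Matrix.transpose_mul, Matrix.mul_assoc, ← Matrix.mul_assoc g, hg.2, Matrix.one_mul]

/-- Some rotation of `H` is both aligned to `G` and closest to `G`. -/
theorem exists_aligned {m : Type*} [Fintype m] (H G : Matrix m (Fin d) ℝ) :
    ∃ g ∈ orthGroup d, ((H * g)ᵀ * G).PosSemidef ∧
      ∀ h ∈ orthGroup d, ‖G - H * g‖ ≤ ‖G - H * h‖ := by
  -- Since `‖H * g‖` does not depend on `g`, the rotation of largest trace is also the nearest one.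
  obtain ⟨g, hg, hpsd, hmax⟩ := exists_polar_factor (Hᵀ * G)
  refine ⟨g, hg, by rwa [Matrix.transpose_mul, Matrix.mul_assoc], fun h hh => ?_⟩
  refine abs_le_of_sq_le_sq' ?_ (norm_nonneg _) |>.2
  have h1 := hmax h hh
  rw [← Matrix.mul_assoc, ← Matrix.mul_assoc, ← Matrix.transpose_mul,
    ← Matrix.transpose_mul] at h1
  rw [norm_sub_sq, norm_sub_sq, trace_transpose_mul_comm G, trace_transpose_mul_comm G,
    norm_mul_of_mul_transpose_self hg.2, norm_mul_of_mul_transpose_self hh.2]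
  linarith

/-- The projection maximizes the inner product over the feasible set. -/
theorem trace_le_of_mem_projOrthProd {X Y : BlockVec n d} (hY : Y ∈ projOrthProd X)
    {Y' : BlockVec n d} (hY' : Y' ∈ orthProd n d) :
    Matrix.trace (Y'ᵀ * X) ≤ Matrix.trace (Yᵀ * X) := by
  rw [trace_transpose_mul_eq_sum_block, trace_transpose_mul_eq_sum_block]
  refine Finset.sum_le_sum fun i _ => ?_
  have h := (hY i).2 _ (hY' i)
  rw [frobNorm_eq_norm, frobNorm_eq_norm] at h
  have h2 := pow_le_pow_left₀ (norm_nonneg _) h 2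
  have e1 : ‖block Y i‖ ^ 2 = d := by
    rw [← trace_transpose_mul_self, ((hY i).1).1]; simp
  have e2 : ‖block Y' i‖ ^ 2 = d := by
    rw [← trace_transpose_mul_self, (hY' i).1]; simp
  rw [norm_sub_sq, norm_sub_sq, e1, e2, trace_transpose_mul_comm, trace_transpose_mul_comm _
    (block Y' i)] at h2
  linarith

theorem mem_orthProd_of_mem_projOrthProd {X Y : BlockVec n d} (hY : Y ∈ projOrthProd X) :
    Y ∈ orthProd n d := fun i => (hY i).1

theorem norm_sub_le_of_mem_projOrthProd {X Y : BlockVec n d} (hY : Y ∈ projOrthProd X)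
    {Y' : BlockVec n d} (hY' : Y' ∈ orthProd n d) : ‖X - Y‖ ≤ ‖X - Y'‖ := by
  refine abs_le_of_sq_le_sq' ?_ (norm_nonneg _) |>.2
  rw [norm_sq_eq_sum_block, norm_sq_eq_sum_block]
  refine Finset.sum_le_sum fun i _ => ?_
  have h := (hY i).2 _ (hY' i)
  rw [frobNorm_eq_norm, frobNorm_eq_norm] at h
  exact pow_le_pow_left₀ (norm_nonneg _) h 2

end Blocks

/-! ### Optimality of the top eigenvectors. -/

section KyFan

variable {n d : ℕ}

/-- The matrix `K` is `c` times a projection, so `K = c⁻¹ KᵀK`. -/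
theorem posSemidef_smul_one_sub_gram {m : Type*} [Fintype m] [DecidableEq m] {c : ℝ}
    {Y : Matrix m (Fin d) ℝ} (hc : 0 < c) (hY : Yᵀ * Y = c • 1) :
    (c • (1 : Matrix m m ℝ) - Y * Yᵀ).PosSemidef := by
  set K := c • (1 : Matrix m m ℝ) - Y * Yᵀ
  have hYY : Y * Yᵀ * (Y * Yᵀ) = c • (Y * Yᵀ) := by
    rw [Matrix.mul_assoc, ← Matrix.mul_assoc Yᵀ, hY, Matrix.smul_mul, Matrix.one_mul,
      Matrix.mul_smul]
  have hs : Kᵀ = K := by simp [K, Matrix.transpose_sub]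
  have hK : Kᵀ * K = c • K := by
    rw [hs]
    simp only [K, Matrix.sub_mul, Matrix.mul_sub, Matrix.smul_mul, Matrix.mul_smul,
      Matrix.one_mul, Matrix.mul_one, hYY]
    module
  have h := (Matrix.posSemidef_conjTranspose_mul_self K).smul (inv_nonneg.mpr hc.le)
  rwa [Matrix.conjTranspose_eq_transpose_of_trivial, hK, smul_smul, inv_mul_cancel₀ hc.ne',
    one_smul] at h

/-- Ky Fan: the scaled top eigenvectors maximize the objective among all matrices with the same
Gram matrix. -/
theorem objective_le_of_isTopEigenvectors (hn : 0 < n) (hd : 0 < d) {C : BlockMat n d}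
    (hC : C.IsSymm) {Φ : BlockVec n d} (hΦ : IsTopEigenvectors C Φ) {Y : BlockVec n d}
    (hY : Yᵀ * Y = (n : ℝ) • 1) : objective C Y ≤ objective C Φ := by
  obtain ⟨hgram, ev, hev, htop⟩ := hΦ
  have hn' : (0 : ℝ) < n := by exact_mod_cast hn
  have : Nonempty (Fin d) := ⟨⟨0, hd⟩⟩
  obtain ⟨j₀, hj₀⟩ := Finite.exists_min ev
  set t := ev j₀
  set D : Matrix (Fin d) (Fin d) ℝ := Matrix.diagonal fun j => ev j - t
  -- Dual certificate: `B` vanishes on the columns of `Φ` and equals `t - C` on their complement,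
  -- with `t` the least selected eigenvalue.
  set B : BlockMat n d := t • 1 + (n : ℝ)⁻¹ • (Φ * D * Φᵀ) - C
  have hCΦ : C * Φ = Φ * Matrix.diagonal ev := by
    ext p j
    have := congrFun (hev j) p
    simp only [Matrix.mulVec, dotProduct, Pi.smul_apply, smul_eq_mul] at this
    rw [Matrix.mul_apply, this, Matrix.mul_diagonal, mul_comm]
  have hBs : Bᵀ = B := by
    simp only [B, D, Matrix.transpose_sub, Matrix.transpose_add, Matrix.transpose_smul,
      Matrix.transpose_one, Matrix.transpose_mul, Matrix.transpose_transpose,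
      Matrix.diagonal_transpose, hC.eq, Matrix.mul_assoc]
  have hDev : D = Matrix.diagonal ev - t • 1 := by
    ext i j
    by_cases h : i = j <;> simp [D, h]
  have hBΦ : B * Φ = 0 := by
    simp only [B, Matrix.sub_mul, Matrix.add_mul, Matrix.smul_mul, Matrix.one_mul, hCΦ]
    rw [Matrix.mul_assoc, hgram, Matrix.mul_smul, Matrix.mul_one, smul_smul,
      inv_mul_cancel₀ hn'.ne', one_smul, hDev, Matrix.mul_sub, Matrix.mul_smul, Matrix.mul_one]
    abel
  have hB : B.PosSemidef := by
    have hH : B.IsHermitian := by simpa [Matrix.IsHermitian] using hBs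
    rw [hH.posSemidef_iff_eigenvalues_nonneg]
    intro p
    by_contra hneg
    have hneg : hH.eigenvalues p < 0 := by simpa using hneg
    set ν := hH.eigenvalues p
    set v : Fin n × Fin d → ℝ := (hH.eigenvectorBasis p).ofLp
    have hv : B *ᵥ v = ν • v := hH.mulVec_eigenvectorBasis p
    have hv0 : v ≠ 0 := by
      intro h
      have := hH.eigenvectorBasis.orthonormal.ne_zero p
      exact this (by ext i; exact congrFun h i)
    -- As `BΦ = 0`, an eigenvector of `B` with `ν < 0` is orthogonal to `Φ`; it would then give `C`
    -- the eigenvalue `t - ν > t` there.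
    have hperp : Φᵀ *ᵥ v = 0 := by
      have h1 : Φᵀ *ᵥ (B *ᵥ v) = 0 := by
        rw [Matrix.mulVec_mulVec, ← hBs, ← Matrix.transpose_mul, hBΦ]
        simp
      rw [hv, Matrix.mulVec_smul] at h1
      exact (smul_eq_zero.mp h1).resolve_left hneg.ne
    have hCv : C *ᵥ v = (t - ν) • v := by
      have h1 : B *ᵥ v = t • v - C *ᵥ v := by
        simp only [B, Matrix.sub_mulVec, Matrix.add_mulVec, Matrix.smul_mulVec, Matrix.one_mulVec]
        rw [← Matrix.mulVec_mulVec, hperp]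
        simp
      rw [hv] at h1
      rw [sub_smul, h1]
      abel
    have := htop v (t - ν) hv0 (fun j => congrFun hperp j) hCv j₀
    linarith
  have h1 : 0 ≤ Matrix.trace (Yᵀ * B * Y) := by
    simpa using (hB.conjTranspose_mul_mul_same Y).trace_nonneg
  have h2 : Matrix.trace (Yᵀ * B * Y) = t * (n * d)
      + (n : ℝ)⁻¹ * Matrix.trace (D * (Φᵀ * Y * (Yᵀ * Φ))) - objective C Y := by
    simp only [B, objective, Matrix.mul_sub, Matrix.mul_add, Matrix.sub_mul, Matrix.add_mul,
      Matrix.mul_smul, Matrix.smul_mul, Matrix.trace_add, Matrix.trace_sub, Matrix.trace_smul,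
      Matrix.mul_one, hY]
    have : Matrix.trace (Yᵀ * (Φ * D * Φᵀ) * Y) = Matrix.trace (D * (Φᵀ * Y * (Yᵀ * Φ))) := by
      rw [show Yᵀ * (Φ * D * Φᵀ) * Y = (Yᵀ * Φ) * (D * (Φᵀ * Y)) by
        simp only [Matrix.mul_assoc], Matrix.trace_mul_comm]
      simp only [Matrix.mul_assoc]
    rw [this]
    simp
  have h3 : Matrix.trace (D * (Φᵀ * Y * (Yᵀ * Φ))) ≤ ∑ j, (ev j - t) * (n : ℝ) ^ 2 := by
    simp only [Matrix.trace, Matrix.diag, D, Matrix.diagonal_mul]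
    refine Finset.sum_le_sum fun j _ => ?_
    refine mul_le_mul_of_nonneg_left ?_ (sub_nonneg.mpr (hj₀ j))
    have hK := ((posSemidef_smul_one_sub_gram hn' hY).conjTranspose_mul_mul_same Φ).diag_nonneg
      (i := j)
    rw [Matrix.conjTranspose_eq_transpose_of_trivial, Matrix.mul_sub, Matrix.sub_mul,
      Matrix.mul_smul, Matrix.mul_one, Matrix.smul_mul, hgram] at hK
    simp only [Matrix.sub_apply, Matrix.smul_apply, Matrix.one_apply_eq, smul_eq_mul, mul_one,
      Matrix.mul_assoc] at hK
    rw [sq, Matrix.mul_assoc]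
    linarith
  have h4 : objective C Φ = n * ∑ j, ev j := by
    rw [objective, Matrix.mul_assoc, hCΦ, ← Matrix.mul_assoc, hgram, Matrix.smul_mul,
      Matrix.one_mul, Matrix.trace_smul, Matrix.trace_diagonal, smul_eq_mul]
  have h5 : (n : ℝ)⁻¹ * ∑ j, (ev j - t) * (n : ℝ) ^ 2 = n * ∑ j, ev j - t * (n * d) := by
    rw [← Finset.sum_mul, Finset.sum_sub_distrib]
    simp
    field_simp
  have h6 := mul_le_mul_of_nonneg_left h3 (inv_nonneg.mpr hn'.le)
  linarith

end KyFan

/-! ### The measurement matrix as signal plus error. -/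

section Model

open scoped Matrix.Norms.Frobenius

variable {n d : ℕ}

/-- The part of the measurement matrix caused by missing or reweighted edges. -/
noncomputable def weightError (μ : ℝ) (W : Matrix (Fin n) (Fin n) ℝ) (H : BlockVec n d) :
    BlockMat n d :=
  (adjBlock d W - μ • ones (Fin n × Fin d)) ⊙ (H * Hᵀ)

theorem measurement_eq (μ : ℝ) (W : Matrix (Fin n) (Fin n) ℝ) (H : BlockVec n d)
    (Δ : BlockMat n d) :
    measurement W H Δ = μ • (H * Hᵀ) + (weightError μ W H + adjBlock d W ⊙ Δ) := by
  ext p q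
  simp [measurement, weightError, ones, Matrix.hadamard_apply]
  ring

theorem adjBlock_apply (W : Matrix (Fin n) (Fin n) ℝ) (p q : Fin n × Fin d) :
    adjBlock d W p q = W p.1 q.1 := by
  simp [adjBlock, ones, Matrix.kroneckerMap_apply]

theorem isSymm_weightError (μ : ℝ) {W : Matrix (Fin n) (Fin n) ℝ} (hW : W.IsSymm)
    (H : BlockVec n d) : (weightError μ W H).IsSymm := by
  ext p q
  have h1 : (H * Hᵀ) q p = (H * Hᵀ) p q := by simp [Matrix.mul_apply, mul_comm]
  simp [weightError, Matrix.hadamard_apply, adjBlock_apply, ones, hW.apply p.1 q.1, h1]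

theorem isSymm_adjBlock_hadamard {W : Matrix (Fin n) (Fin n) ℝ} (hW : W.IsSymm)
    {Δ : BlockMat n d} (hΔ : Δ.IsSymm) : (adjBlock d W ⊙ Δ).IsSymm := by
  ext p q
  simp [Matrix.hadamard_apply, adjBlock_apply, hW.apply p.1 q.1, hΔ.apply p q]

theorem block_weightError_mul (μ : ℝ) (W : Matrix (Fin n) (Fin n) ℝ) (H Y : BlockVec n d)
    (i : Fin n) : block (weightError μ W H * Y) i =
      ∑ j, (W - μ • ones (Fin n)) i j • (block H i * ((block H j)ᵀ * block Y j)) := by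
  ext a b
  simp only [← Matrix.mul_assoc]
  simp [block, Matrix.mul_apply, Fintype.sum_prod_type, Matrix.sum_apply, weightError,
    Matrix.hadamard_apply, adjBlock_apply, ones, Finset.mul_sum, mul_assoc]
  refine Finset.sum_congr rfl fun j _ => ?_
  rw [Finset.sum_comm (f := fun c e => (W i j - μ) * (H (i, a) c * (H (j, e) c * Y (j, e) b)))]
  refine Finset.sum_congr rfl fun e _ => ?_
  rw [Finset.sum_mul]
  exact Finset.sum_congr rfl fun c _ => by ring

/-- Block `(i,j)` of the error is `(W - μ11ᵀ)ᵢⱼ HᵢHⱼᵀ`. Replacing `Xᵢ` by `HᵢᵀXᵢ` and flattening it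
into a row is an isometry `V` under which the error acts as `W - μ11ᵀ`. -/
theorem abs_trace_weightError_le (μ : ℝ) (W : Matrix (Fin n) (Fin n) ℝ) {H : BlockVec n d}
    (hH : H ∈ orthProd n d) (X Y : BlockVec n d) :
    |Matrix.trace (Xᵀ * (weightError μ W H * Y))| ≤
      opNorm (W - μ • ones (Fin n)) * ‖X‖ * ‖Y‖ := by
  let V : BlockVec n d → Matrix (Fin n) (Fin d × Fin d) ℝ := fun X =>
    Matrix.of fun i p => ((block H i)ᵀ * block X i) p.1 p.2
  have hV : ∀ X, ‖V X‖ = ‖X‖ := by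
    intro X
    rw [← sq_eq_sq₀ (norm_nonneg _) (norm_nonneg _), norm_sq_eq_sum_block, norm_sq_eq_sum]
    refine Finset.sum_congr rfl fun i _ => ?_
    rw [← norm_mul_of_transpose_mul_self (g := (block H i)ᵀ) (by simpa using (hH i).2),
      norm_sq_eq_sum, Fintype.sum_prod_type]
    rfl
  have hT : Matrix.trace (Xᵀ * (weightError μ W H * Y)) =
      Matrix.trace ((V X)ᵀ * ((W - μ • ones (Fin n)) * V Y)) := by
    rw [trace_transpose_mul_eq_sum_block, trace_transpose_mul]
    refine Finset.sum_congr rfl fun i _ => ?_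
    rw [block_weightError_mul, Matrix.mul_sum, Matrix.trace_sum]
    simp only [Matrix.mul_apply (M := W - μ • ones (Fin n)), Finset.mul_sum]
    rw [Finset.sum_comm]
    refine Finset.sum_congr rfl fun j _ => ?_
    rw [Matrix.mul_smul, Matrix.trace_smul, ← Matrix.mul_assoc,
      show (block X i)ᵀ * block H i = ((block H i)ᵀ * block X i)ᵀ by
        rw [Matrix.transpose_mul, Matrix.transpose_transpose],
      trace_transpose_mul, smul_eq_mul, Fintype.sum_prod_type, Finset.mul_sum]
    refine Finset.sum_congr rfl fun a _ => ?_
    rw [Finset.mul_sum]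
    refine Finset.sum_congr rfl fun b _ => ?_
    simp only [V, Matrix.of_apply]
    ring
  rw [hT, ← hV X, ← hV Y]
  exact abs_trace_le_opNorm _ _ _

theorem blockCol_transpose_mul {A : BlockMat n d} (hA : A.IsSymm) (Y : BlockVec n d) (i : Fin n) :
    (blockCol A i)ᵀ * Y = block (A * Y) i := by
  ext a b
  simp only [Matrix.mul_apply, Matrix.transpose_apply, blockCol, block, Matrix.of_apply]
  exact Finset.sum_congr rfl fun p _ => by rw [hA.apply]

end Model

/-! ### Optimality conditions and curvature. -/

section Optimality

open scoped Matrix.Norms.Frobenius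

variable {n d : ℕ}

theorem objective_add {C : BlockMat n d} (hC : C.IsSymm) (G X : BlockVec n d) :
    objective C (G + X) =
      objective C G + 2 * Matrix.trace (Xᵀ * (C * G)) + Matrix.trace (Xᵀ * (C * X)) := by
  have hx : Matrix.trace (Gᵀ * (C * X)) = Matrix.trace (Xᵀ * (C * G)) := by
    rw [← Matrix.trace_transpose]
    simp only [Matrix.transpose_mul, Matrix.transpose_transpose, hC.eq, Matrix.mul_assoc]
  simp only [objective, Matrix.transpose_add, Matrix.add_mul, Matrix.mul_add, Matrix.trace_add,
    Matrix.mul_assoc]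
  linarith

/-- The block vector with `Z` in position `i` and zero elsewhere. -/
noncomputable def singleBlock (i : Fin n) (Z : Matrix (Fin d) (Fin d) ℝ) : BlockVec n d :=
  Matrix.of fun p b => if p.1 = i then Z p.2 b else 0

theorem block_singleBlock (i j : Fin n) (Z : Matrix (Fin d) (Fin d) ℝ) :
    block (singleBlock i Z) j = if j = i then Z else 0 := by
  ext a b
  by_cases h : j = i <;> simp [block, singleBlock, h]

theorem trace_singleBlock_mul (i : Fin n) (Z : Matrix (Fin d) (Fin d) ℝ) (A : BlockVec n d) :
    Matrix.trace ((singleBlock i Z)ᵀ * A) = Matrix.trace (Zᵀ * block A i) := by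
  rw [trace_transpose_mul_eq_sum_block, Finset.sum_eq_single i]
  · simp [block_singleBlock]
  · intro j _ hj
    simp [block_singleBlock, hj]
  · simp

theorem block_mul_singleBlock {C : BlockMat n d} {μ : ℝ} {i : Fin n}
    (hdiag : ∀ a b, C (i, a) (i, b) = μ * (1 : Matrix (Fin d) (Fin d) ℝ) a b)
    (Z : Matrix (Fin d) (Fin d) ℝ) : block (C * singleBlock i Z) i = μ • Z := by
  ext a b
  simp [block, singleBlock, Matrix.mul_apply, Fintype.sum_prod_type, hdiag, Matrix.one_apply]

/-- Changing only block `i` to `Z` contributes the second-order term `μ‖Z - Yᵢ‖² ≥ 0`, so the linear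
term cannot be positive: `Yᵢ` maximizes `tr(Zᵀ(CY)ᵢ)`. -/
theorem posSemidef_block_of_isGlobalMaximizer {C : BlockMat n d} (hC : C.IsSymm) {μ : ℝ}
    (hμ : 0 ≤ μ) {Y : BlockVec n d} (hY : IsGlobalMaximizer C Y) {i : Fin n}
    (hdiag : ∀ a b, C (i, a) (i, b) = μ * (1 : Matrix (Fin d) (Fin d) ℝ) a b) :
    ((block Y i)ᵀ * block (C * Y) i).PosSemidef := by
  refine posSemidef_of_maximizes (hY.1 i) fun Z hZ => ?_
  set E := singleBlock i (Z - block Y i)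
  have hmem : Y + E ∈ orthProd n d := by
    intro j
    rw [block_add, block_singleBlock]
    by_cases h : j = i
    · subst h; simpa using hZ
    · simpa [h] using hY.1 j
  have h1 := hY.2 _ hmem
  rw [objective_add hC, trace_singleBlock_mul, trace_singleBlock_mul,
    block_mul_singleBlock hdiag, Matrix.mul_smul, Matrix.trace_smul, trace_transpose_mul_self,
    Matrix.transpose_sub, Matrix.sub_mul, Matrix.trace_sub, smul_eq_mul] at h1
  have : 0 ≤ μ * ‖Z - block Y i‖ ^ 2 := by positivity
  linarith

/-- A positive semidefinite polar factor inherits lower bounds on singular values. -/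
theorem posSemidef_mul_transpose_sub {Q M : Matrix (Fin d) (Fin d) ℝ} (hQ : Q ∈ orthGroup d)
    (hM : (Qᵀ * M).PosSemidef) {κ : ℝ} (hκ : ∀ y : Matrix (Fin d) Unit ℝ, κ * ‖y‖ ≤ ‖M * y‖) :
    (M * Qᵀ - κ • 1).PosSemidef := by
  have hS : (M * Qᵀ).PosSemidef := by
    have := hM.mul_mul_conjTranspose_same Q
    rwa [Matrix.conjTranspose_eq_transpose_of_trivial, ← Matrix.mul_assoc, hQ.2,
      Matrix.one_mul] at this
  have hH : (M * Qᵀ - κ • 1).IsHermitian :=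
    hS.isHermitian.sub (by simp [Matrix.IsHermitian])
  rw [hH.posSemidef_iff_eigenvalues_nonneg]
  intro p
  simp only [Pi.zero_apply]
  set ν := hH.eigenvalues p
  set v : Fin d → ℝ := (hH.eigenvectorBasis p).ofLp
  have hv : (M * Qᵀ) *ᵥ v = (ν + κ) • v := by
    have h : (M * Qᵀ - κ • 1) *ᵥ v = ν • v := hH.mulVec_eigenvectorBasis p
    rw [Matrix.sub_mulVec, Matrix.smul_mulVec, Matrix.one_mulVec, sub_eq_iff_eq_add] at h
    rw [h, add_smul]
  have hv0 : v ≠ 0 := fun h =>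
    hH.eigenvectorBasis.orthonormal.ne_zero p (by ext i; exact congrFun h i)
  have hvv : 0 < v ⬝ᵥ v :=
    lt_of_le_of_ne (dotProduct_self_star_nonneg v) fun h => hv0 (dotProduct_self_eq_zero.mp h.symm)
  have hnn : 0 ≤ ν + κ := by
    have := hS.dotProduct_mulVec_nonneg v
    rw [hv, star_trivial, dotProduct_smul, smul_eq_mul] at this
    exact nonneg_of_mul_nonneg_left this hvv
  -- As a one-column matrix, `v` has its Euclidean norm as Frobenius norm; testing `hκ` at `Qᵀ * y`
  -- gives `κ ≤ ν + κ`.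
  set y : Matrix (Fin d) Unit ℝ := Matrix.of fun i _ => v i
  have hy : M * (Qᵀ * y) = (ν + κ) • y := by
    rw [← Matrix.mul_assoc]
    ext i j
    exact congrFun hv i
  have hy0 : 0 < ‖y‖ := by
    rw [norm_pos_iff]
    intro h
    exact hv0 (funext fun i => congrFun (congrFun h i) ())
  have h1 := hκ (Qᵀ * y)
  rw [hy, norm_mul_of_transpose_mul_self (by simpa using hQ.2), norm_smul, Real.norm_eq_abs,
    abs_of_nonneg hnn] at h1
  linarith [le_of_mul_le_mul_right h1 hy0]

/-- Orthogonality of `Q` and `Q + X` turns a linear term into a quadratic one. -/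
theorem trace_transpose_mul_eq_neg_half {S Q X : Matrix (Fin d) (Fin d) ℝ} (hS : Sᵀ = S)
    (hQ : Q ∈ orthGroup d) (hX : Q + X ∈ orthGroup d) :
    Matrix.trace (Xᵀ * (S * Q)) = -(1 / 2) * Matrix.trace (Xᵀ * (S * X)) := by
  -- The form is constant on the orthogonal group; expanding it at `Q + X` relates its linear and
  -- quadratic parts.
  have h : ∀ g ∈ orthGroup d, Matrix.trace (gᵀ * (S * g)) = Matrix.trace S := by
    intro g hg
    rw [Matrix.trace_mul_comm, Matrix.mul_assoc, hg.2, Matrix.mul_one]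
  have h1 := h _ hX
  have h2 := h _ hQ
  have hx : Matrix.trace (Qᵀ * (S * X)) = Matrix.trace (Xᵀ * (S * Q)) := by
    rw [← Matrix.trace_transpose]
    simp only [Matrix.transpose_mul, Matrix.transpose_transpose, hS, Matrix.mul_assoc]
  simp only [Matrix.transpose_add, Matrix.add_mul, Matrix.mul_add, Matrix.trace_add] at h1
  linarith

/-- The gap of the objective and of its linearization around a point whose block multipliers are
bounded below by `κ`. -/
theorem exists_curvature {C : BlockMat n d} (hC : C.IsSymm) {Y G : BlockVec n d}
    (hY : Y ∈ orthProd n d) (hG : G ∈ orthProd n d) {κ : ℝ}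
    (hκ : ∀ i, (block (C * Y) i * (block Y i)ᵀ - κ • 1).PosSemidef) :
    ∃ s, κ * ‖G - Y‖ ^ 2 ≤ s ∧
      objective C Y - objective C G = s - Matrix.trace ((G - Y)ᵀ * (C * (G - Y))) ∧
      Matrix.trace ((Y - G)ᵀ * (C * G)) =
        s / 2 - Matrix.trace ((G - Y)ᵀ * (C * (G - Y))) := by
  set X := G - Y with hX
  set S : Fin n → Matrix (Fin d) (Fin d) ℝ := fun i => block (C * Y) i * (block Y i)ᵀ
  have hSs : ∀ i, (S i)ᵀ = S i := by
    intro i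
    have h := (hκ i).isHermitian.eq
    rw [Matrix.conjTranspose_eq_transpose_of_trivial, Matrix.transpose_sub, Matrix.transpose_smul,
      Matrix.transpose_one] at h
    exact sub_left_injective h
  have hSY : ∀ i, S i * block Y i = block (C * Y) i := by
    intro i
    rw [Matrix.mul_assoc, (hY i).1, Matrix.mul_one]
  have hlin : Matrix.trace (Xᵀ * (C * Y)) =
      -(1 / 2) * ∑ i, Matrix.trace ((block X i)ᵀ * (S i * block X i)) := by
    rw [trace_transpose_mul_eq_sum_block, Finset.mul_sum]
    refine Finset.sum_congr rfl fun i _ => ?_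
    rw [← hSY, trace_transpose_mul_eq_neg_half (hSs i) (hY i)]
    rw [← block_add, hX, add_sub_cancel]
    exact hG i
  refine ⟨∑ i, Matrix.trace ((block X i)ᵀ * (S i * block X i)), ?_, ?_, ?_⟩
  · rw [norm_sq_eq_sum_block, Finset.mul_sum]
    refine Finset.sum_le_sum fun i _ => ?_
    have h := ((hκ i).conjTranspose_mul_mul_same (block X i)).trace_nonneg
    rw [Matrix.conjTranspose_eq_transpose_of_trivial, Matrix.mul_sub, Matrix.sub_mul,
      Matrix.trace_sub, Matrix.mul_smul, Matrix.smul_mul, Matrix.trace_smul, Matrix.mul_one,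
      trace_transpose_mul_self, Matrix.mul_assoc, smul_eq_mul] at h
    linarith
  · have := objective_add hC Y X
    rw [hX, add_sub_cancel, ← hX, hlin] at this
    linarith
  · have h1 : G = Y + X := by rw [hX, add_sub_cancel]
    have h2 : Y - G = -X := by rw [hX, neg_sub]
    rw [h2, h1, Matrix.mul_add, Matrix.transpose_neg, Matrix.neg_mul, Matrix.mul_add,
      Matrix.trace_neg, Matrix.trace_add, hlin]
    linarith

end Optimality

/-! ### The basin of attraction and one-step contraction. -/

section Convergence

open scoped Matrix.Norms.Frobenius

variable {n d : ℕ}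

/-- `C = μ H Hᵀ + R` with `R` symmetric of operator norm at most `η`, where `η` is small and `e`
is the resulting scale of the estimation error. -/
structure IsPerturbation (C : BlockMat n d) (H : BlockVec n d) (R : BlockMat n d)
    (μ η e : ℝ) : Prop where
  eq : C = μ • (H * Hᵀ) + R
  symm : R.IsSymm
  bound : ∀ X Y : BlockVec n d, |Matrix.trace (Xᵀ * (R * Y))| ≤ η * ‖X‖ * ‖Y‖
  mem : H ∈ orthProd n d
  n_pos : 0 < n
  μ_pos : 0 < μ
  η_nonneg : 0 ≤ η
  e_nonneg : 0 ≤ e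
  sqrt_mul_η : √(n * d) * η ≤ n * μ * e / 4
  e_sq : e ^ 2 ≤ n / 225
  η_le : η ≤ n * μ / 60

namespace IsPerturbation

variable {C R : BlockMat n d} {H : BlockVec n d} {μ η e : ℝ}

theorem nμ_pos (hP : IsPerturbation C H R μ η e) : 0 < n * μ :=
  mul_pos (by exact_mod_cast hP.n_pos) hP.μ_pos

theorem isSymm (hP : IsPerturbation C H R μ η e) : C.IsSymm := by
  have h : (H * Hᵀ)ᵀ = H * Hᵀ := by rw [Matrix.transpose_mul, Matrix.transpose_transpose]
  rw [Matrix.IsSymm, hP.eq, Matrix.transpose_add, Matrix.transpose_smul, h, hP.symm.eq]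

theorem gap_bounds (hP : IsPerturbation C H R μ η e) {G : BlockVec n d}
    (hG : Gᵀ * G = (n : ℝ) • 1) {g : Matrix (Fin d) (Fin d) ℝ} (hg : g ∈ orthGroup d)
    (hpsd : ((H * g)ᵀ * G).PosSemidef) :
    n * μ * (‖G - H * g‖ ^ 2 / 2 - e / 2 * ‖G - H * g‖) ≤ objective C H - objective C G ∧
      objective C H - objective C G ≤ n * μ * (‖G - H * g‖ ^ 2 + e / 2 * ‖G - H * g‖) := by
  have h := objective_gap_bounds hP.symm hP.bound hP.η_nonneg hP.μ_pos.le hG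
    (gram_mul_orth (gram_of_mem_orthProd hP.mem) hg) hpsd
  rw [mul_orth_mul_transpose H hg, ← hP.eq, objective_mul_orth C H hg] at h
  have h2 : 2 * √(n * d) * η * ‖G - H * g‖ ≤ n * μ * e / 2 * ‖G - H * g‖ :=
    mul_le_mul_of_nonneg_right (by linarith [hP.sqrt_mul_η]) (norm_nonneg _)
  constructor <;> linarith [h.1, h.2]

/-- Anything at least as good as the ground truth is within `e` of it. -/
theorem exists_dist_le (hP : IsPerturbation C H R μ η e) {G : BlockVec n d}
    (hG : Gᵀ * G = (n : ℝ) • 1) (hf : objective C H ≤ objective C G) :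
    ∃ g ∈ orthGroup d, ((H * g)ᵀ * G).PosSemidef ∧ ‖G - H * g‖ ≤ e := by
  obtain ⟨g, hg, hpsd, -⟩ := exists_aligned H G
  refine ⟨g, hg, hpsd, ?_⟩
  have h := (hP.gap_bounds hG hg hpsd).1
  set x := ‖G - H * g‖
  have h1 : x ^ 2 / 2 - e / 2 * x ≤ 0 := by
    by_contra hc
    push Not at hc
    linarith [mul_pos hP.nμ_pos hc]
  by_contra! hc
  nlinarith [hP.e_nonneg]

/-- At distance `x = 2e` the upper gap bound is `x² + ex/2 = 5e²`. -/
theorem objective_ge_of_dist_le (hP : IsPerturbation C H R μ η e) {G : BlockVec n d}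
    (hG : G ∈ orthProd n d) {h : Matrix (Fin d) (Fin d) ℝ} (hh : h ∈ orthGroup d)
    (hd : ‖G - H * h‖ ≤ 2 * e) : objective C H - objective C G ≤ n * μ * (5 * e ^ 2) := by
  obtain ⟨g, hg, hpsd, hmin⟩ := exists_aligned H G
  refine (hP.gap_bounds (gram_of_mem_orthProd hG) hg hpsd).2.trans ?_
  have hx := (hmin h hh).trans hd
  refine mul_le_mul_of_nonneg_left ?_ hP.nμ_pos.le
  have h0 := norm_nonneg (G - H * g)
  have he := hP.e_nonneg
  nlinarith

/-- At `x = 4e` the lower gap bound is already `8e² - 2e² = 6e²`, above `5e²`. -/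
theorem exists_dist_le_of_objective_ge (hP : IsPerturbation C H R μ η e) {G : BlockVec n d}
    (hG : G ∈ orthProd n d) (hf : objective C H - objective C G ≤ n * μ * (5 * e ^ 2)) :
    ∃ g ∈ orthGroup d, ‖G - H * g‖ ≤ 4 * e := by
  obtain ⟨g, hg, hpsd, -⟩ := exists_aligned H G
  refine ⟨g, hg, ?_⟩
  have h := (hP.gap_bounds (gram_of_mem_orthProd hG) hg hpsd).1
  set x := ‖G - H * g‖
  have h1 : x ^ 2 / 2 - e / 2 * x ≤ 5 * e ^ 2 := le_of_mul_le_mul_left (h.trans hf) hP.nμ_pos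
  by_contra! hc
  nlinarith [hP.e_nonneg]

/-- `Φ` beats `H`, hence lies within `e` of some `H * g`; projecting to the nearest feasible point
at most doubles this distance. -/
theorem initial_gap (hP : IsPerturbation C H R μ η e) (hd : 0 < d) {Φ G : BlockVec n d}
    (hΦ : IsTopEigenvectors C Φ) (hG : G ∈ projOrthProd Φ) :
    objective C H - objective C G ≤ n * μ * (5 * e ^ 2) := by
  obtain ⟨g, hg, -, hle⟩ := hP.exists_dist_le hΦ.1
    (objective_le_of_isTopEigenvectors hP.n_pos hd hP.isSymm hΦ (gram_of_mem_orthProd hP.mem))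
  refine hP.objective_ge_of_dist_le (mem_orthProd_of_mem_projOrthProd hG) hg ?_
  have h1 := norm_sub_le_of_mem_projOrthProd hG (mul_orth_mem_orthProd hP.mem hg)
  have h2 := norm_sub_le_norm_sub_add_norm_sub G Φ (H * g)
  rw [norm_sub_rev G Φ] at h2
  linarith

/-- Alignment gives `YᵀX = -XᵀX/2`, so `‖YᵀX‖ ≤ (5e/2)‖X‖`. Passing from `Y` to `H * h` costs
`e‖X‖`, and `(7e/2)² ≤ 49n/900`; adding `η ≤ nμ/60` stays below `3nμ/40`. -/
theorem abs_quadratic_le (hP : IsPerturbation C H R μ η e) {Y G : BlockVec n d}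
    (hY : Y ∈ orthProd n d) (hG : G ∈ orthProd n d) {h : Matrix (Fin d) (Fin d) ℝ}
    (hh : h ∈ orthGroup d) (hYH : ‖Y - H * h‖ ≤ e) (hpsd : (Yᵀ * G).PosSemidef)
    (hGY : ‖G - Y‖ ≤ 5 * e) :
    |Matrix.trace ((G - Y)ᵀ * (C * (G - Y)))| ≤ n * μ * (3 / 40) * ‖G - Y‖ ^ 2 := by
  have hYX : Yᵀ * (G - Y) = -((1 / 2 : ℝ) • ((G - Y)ᵀ * (G - Y))) := by
    rw [Matrix.mul_sub, transpose_mul_eq_of_posSemidef (gram_of_mem_orthProd hG)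
      (gram_of_mem_orthProd hY) hpsd, gram_of_mem_orthProd hY]
    abel
  set X := G - Y
  have hq : Matrix.trace (Xᵀ * (C * X)) = μ * ‖Hᵀ * X‖ ^ 2 + Matrix.trace (Xᵀ * (R * X)) := by
    rw [← objective_lowRank_add, ← hP.eq, objective, Matrix.mul_assoc]
  have h0 : 0 ≤ ‖X‖ := norm_nonneg X
  have h1 : ‖Yᵀ * X‖ ≤ 1 / 2 * ‖X‖ ^ 2 := by
    rw [hYX, norm_neg, norm_smul]
    have := Matrix.frobenius_norm_mul Xᵀ X
    rw [Matrix.frobenius_norm_transpose] at this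
    norm_num
    linarith
  have h2 : ‖(H * h - Y)ᵀ * X‖ ≤ e * ‖X‖ := by
    refine (Matrix.frobenius_norm_mul _ _).trans ?_
    rw [Matrix.frobenius_norm_transpose, norm_sub_rev]
    gcongr
  have h3 : ‖Hᵀ * X‖ ≤ 7 / 2 * e * ‖X‖ := by
    have e1 : ‖Hᵀ * X‖ = ‖Yᵀ * X + (H * h - Y)ᵀ * X‖ := by
      rw [← Matrix.add_mul, Matrix.transpose_sub, add_sub_cancel, Matrix.transpose_mul,
        Matrix.mul_assoc, norm_mul_of_transpose_mul_self (g := hᵀ) (by simpa using hh.2)]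
    rw [e1]
    refine (norm_add_le _ _).trans ?_
    nlinarith
  have h4 : ‖Hᵀ * X‖ ^ 2 ≤ 49 / 900 * n * ‖X‖ ^ 2 := by
    refine (pow_le_pow_left₀ (norm_nonneg _) h3 2).trans ?_
    rw [mul_pow, mul_pow]
    refine mul_le_mul_of_nonneg_right ?_ (sq_nonneg _)
    linarith [hP.e_sq]
  have h5 := hP.bound X X
  have h6 : η * ‖X‖ * ‖X‖ ≤ n * μ / 60 * ‖X‖ ^ 2 := by
    rw [mul_assoc, ← sq]
    exact mul_le_mul_of_nonneg_right hP.η_le (sq_nonneg _)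
  have h7 := mul_le_mul_of_nonneg_left h4 hP.μ_pos.le
  have h8 : 0 ≤ μ * ‖Hᵀ * X‖ ^ 2 := mul_nonneg hP.μ_pos.le (sq_nonneg _)
  have h9 : 0 ≤ n * μ * ‖X‖ ^ 2 := mul_nonneg hP.nμ_pos.le (sq_nonneg _)
  rw [hq]
  refine (abs_add_le _ _).trans ?_
  rw [abs_of_nonneg h8]
  linarith

/-- For `α ≥ η` the form of `C + αI` is convex and so lies above its linearization; the shift adds
the same constant to `f` at every feasible point. -/
theorem objective_step (hP : IsPerturbation C H R μ η e) {α : ℝ} (hα : η ≤ α)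
    {G G' : BlockVec n d} (hG : G ∈ orthProd n d)
    (hG' : G' ∈ projOrthProd ((C + α • (1 : BlockMat n d)) * G)) :
    objective C G + 2 * Matrix.trace ((G' - G)ᵀ * ((C + α • (1 : BlockMat n d)) * G)) ≤
      objective C G' := by
  have hG'm := mem_orthProd_of_mem_projOrthProd hG'
  have hT : ∀ Z : BlockVec n d,
      objective (C + α • (1 : BlockMat n d)) Z = objective C Z + α * ‖Z‖ ^ 2 := by
    intro Z
    rw [objective, Matrix.mul_add, Matrix.add_mul, Matrix.trace_add, Matrix.mul_smul,
      Matrix.smul_mul, Matrix.trace_smul, Matrix.mul_one, trace_transpose_mul_self, objective,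
      smul_eq_mul]
  have hs : (C + α • (1 : BlockMat n d)).IsSymm := by
    rw [Matrix.IsSymm, Matrix.transpose_add, Matrix.transpose_smul, Matrix.transpose_one,
      hP.isSymm.eq]
  have h1 := objective_add hs G (G' - G)
  rw [add_sub_cancel, hT, hT, norm_sq_of_gram (gram_of_mem_orthProd hG),
    norm_sq_of_gram (gram_of_mem_orthProd hG'm)] at h1
  have h2 : 0 ≤ Matrix.trace ((G' - G)ᵀ * ((C + α • (1 : BlockMat n d)) * (G' - G))) := by
    have := hT (G' - G)
    rw [objective, Matrix.mul_assoc] at this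
    rw [this]
    conv_rhs => rw [hP.eq]
    rw [objective_lowRank_add]
    have h3 := (abs_le.mp (hP.bound (G' - G) (G' - G))).1
    have h4 : 0 ≤ μ * ‖Hᵀ * (G' - G)‖ ^ 2 := mul_nonneg hP.μ_pos.le (sq_nonneg _)
    have h5 : 0 ≤ (α - η) * ‖G' - G‖ ^ 2 := mul_nonneg (by linarith) (sq_nonneg _)
    linarith
  linarith

theorem objective_mono (hP : IsPerturbation C H R μ η e) {α : ℝ} (hα : η ≤ α)
    {G G' : BlockVec n d} (hG : G ∈ orthProd n d)
    (hG' : G' ∈ projOrthProd ((C + α • (1 : BlockMat n d)) * G)) :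
    objective C G ≤ objective C G' := by
  have h1 := hP.objective_step hα hG hG'
  have h2 := trace_le_of_mem_projOrthProd hG' hG
  rw [Matrix.transpose_sub, Matrix.sub_mul, Matrix.trace_sub] at h1
  linarith

/-- In the basin of attraction one step of the power method contracts the optimality gap, and the
gap dominates the squared distance. -/
theorem contraction (hP : IsPerturbation C H R μ η e) {α : ℝ} (hα : η ≤ α)
    (hα' : α ≤ n * μ / 30) {Y G : BlockVec n d} (hY : Y ∈ orthProd n d) (hG : G ∈ orthProd n d)
    (hκ : ∀ i, (block (C * Y) i * (block Y i)ᵀ - (n * μ * (79 / 100)) • 1).PosSemidef)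
    {h : Matrix (Fin d) (Fin d) ℝ}
    (hh : h ∈ orthGroup d) (hYH : ‖Y - H * h‖ ≤ e) (hpsd : (Yᵀ * G).PosSemidef)
    (hGY : ‖G - Y‖ ≤ 5 * e) :
    n * μ / 2 * ‖G - Y‖ ^ 2 ≤ objective C Y - objective C G ∧
      ∀ G' ∈ projOrthProd ((C + α • (1 : BlockMat n d)) * G),
        objective C Y - objective C G' ≤ (objective C Y - objective C G) * (1 / 2) := by
  obtain ⟨s, hs, hgap, hlin⟩ := exists_curvature hP.isSymm hY hG hκ
  have hq := abs_le.mp (hP.abs_quadratic_le hY hG hh hYH hpsd hGY)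
  have hx : 0 ≤ n * μ * ‖G - Y‖ ^ 2 := mul_nonneg hP.nμ_pos.le (sq_nonneg _)
  refine ⟨by linarith [hq.2], fun G' hG' => ?_⟩
  have h1 := hP.objective_step hα hG hG'
  have h2 := trace_le_of_mem_projOrthProd hG' hY
  have hsub : ∀ A B Z : BlockVec n d, Matrix.trace ((A - B)ᵀ * Z) =
      Matrix.trace (Aᵀ * Z) - Matrix.trace (Bᵀ * Z) := fun A B Z => by
    rw [Matrix.transpose_sub, Matrix.sub_mul, Matrix.trace_sub]
  have h3 : Matrix.trace ((Y - G)ᵀ * ((C + α • (1 : BlockMat n d)) * G)) =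
      s / 2 - Matrix.trace ((G - Y)ᵀ * (C * (G - Y))) - α / 2 * ‖G - Y‖ ^ 2 := by
    rw [Matrix.add_mul, Matrix.mul_add, Matrix.trace_add, hlin, Matrix.smul_mul, Matrix.mul_smul,
      Matrix.trace_smul, Matrix.one_mul, norm_sub_sq, hsub Y G G, trace_transpose_mul_self, norm_sq_of_gram (gram_of_mem_orthProd hG),
      norm_sq_of_gram (gram_of_mem_orthProd hY), trace_transpose_mul_comm Y G, smul_eq_mul]
    ring
  have h4 : α / 2 * ‖G - Y‖ ^ 2 ≤ n * μ / 30 / 2 * ‖G - Y‖ ^ 2 := by gcongr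
  rw [hsub] at h1 h3
  -- The gain exceeds half the gap by at least `s/2 - 3q/2 - α‖X‖²`, and `0.395 - 0.1125 - 1/30 >
  -- 0`.
  linarith [hq.1, hq.2]

end IsPerturbation

end Convergence

/-! ### Lower bound for the block multipliers. -/

section Multipliers

open scoped Matrix.Norms.Frobenius

variable {n d : ℕ}

theorem opNorm_block_le_blockInfNorm (X : BlockVec n d) (i : Fin n) :
    opNorm (block X i) ≤ blockInfNorm X :=
  le_ciSup (f := fun i => opNorm (block X i)) (Set.finite_range _).bddAbove i

/-- The block multipliers at a global maximizer are bounded below. -/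
theorem posSemidef_multiplier_sub {W : Matrix (Fin n) (Fin n) ℝ} (hW : W.IsSymm) {μ η e : ℝ}
    (hWμ : ∀ i, W i i = μ) {H : BlockVec n d} {Δ : BlockMat n d} (hΔ : IsNoise Δ)
    (hP : IsPerturbation (measurement W H Δ) H (weightError μ W H + adjBlock d W ⊙ Δ) μ η e)
    (hN : opNorm (adjBlock d W ⊙ Δ) ≤ η) (hηe : η * e ≤ n * μ / 900)
    (hNH : blockInfNorm ((adjBlock d W ⊙ Δ) * H) ≤ n * μ / 10) {Y : BlockVec n d}
    (hY : IsGlobalMaximizer (measurement W H Δ) Y)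
    (hWY : ∀ i : Fin n, opNorm ((blockCol (weightError μ W H) i)ᵀ * Y) ≤ n * μ / 10) (i : Fin n) :
    (block (measurement W H Δ * Y) i * (block Y i)ᵀ - (n * μ * (79 / 100)) • 1).PosSemidef := by
  refine posSemidef_mul_transpose_sub (hY.1 i) ?_ fun y => ?_
  · refine posSemidef_block_of_isGlobalMaximizer hP.isSymm hP.μ_pos.le hY fun a b => ?_
    have h := congrFun (congrFun (hP.mem i).2 a) b
    rw [Matrix.mul_apply] at h
    simp only [measurement, Matrix.hadamard_apply, adjBlock_apply, hWμ, Matrix.add_apply,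
      hΔ.2 i a b, add_zero, Matrix.mul_apply, Matrix.transpose_apply]
    rw [← h]
    rfl
  obtain ⟨h, hh, hpsd, hle⟩ := hP.exists_dist_le (gram_of_mem_orthProd hY.1) (hY.2 _ hP.mem)
  have hHh := mul_orth_mem_orthProd hP.mem hh
  have hE := transpose_mul_eq_of_posSemidef (gram_of_mem_orthProd hY.1) (gram_of_mem_orthProd hHh)
    hpsd
  set N := adjBlock d W ⊙ Δ
  set X := Y - H * h with hX
  -- The signal term has size at least `nμ(1 - 1/450)‖y‖`; the weight error, noise on `H` and noise
  -- on `X` cost `1/10`, `1/10` and `1/900` of `nμ‖y‖`, leaving more than `79/100`.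
  have hsplit : block (measurement W H Δ * Y) i * y =
      μ • (block (H * h) i * ((H * h)ᵀ * Y * y)) + (block (weightError μ W H * Y) i * y +
        (block (N * H) i * (h * y) + block (N * X) i * y)) := by
    have e1 : measurement W H Δ * Y =
        μ • (H * h * ((H * h)ᵀ * Y)) + (weightError μ W H * Y + (N * H * h + N * X)) := by
      rw [measurement_eq μ, ← mul_orth_mul_transpose H hh, Matrix.add_mul, Matrix.add_mul,
        Matrix.smul_mul, Matrix.mul_assoc N H h, ← Matrix.mul_add, hX, add_sub_cancel,
        Matrix.mul_assoc (H * h)]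
    rw [e1]
    simp only [block_add, block_smul, block_mul (N * H), block_mul (H * h), Matrix.add_mul,
      Matrix.smul_mul, Matrix.mul_assoc (block _ _)]
  have hy := norm_nonneg y
  have hmain : n * ‖y‖ - 1 / 2 * e ^ 2 * ‖y‖ ≤ ‖block (H * h) i * ((H * h)ᵀ * Y * y)‖ := by
    rw [norm_mul_of_transpose_mul_self (hHh i).1, hE, Matrix.sub_mul, Matrix.smul_mul,
      Matrix.smul_mul, Matrix.one_mul]
    refine le_trans ?_ (norm_sub_norm_le _ _)
    have h1 : ‖Xᵀ * X * y‖ ≤ e ^ 2 * ‖y‖ := by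
      refine (Matrix.frobenius_norm_mul _ _).trans (mul_le_mul_of_nonneg_right ?_ hy)
      refine (Matrix.frobenius_norm_mul _ _).trans ?_
      rw [Matrix.frobenius_norm_transpose, ← sq]
      exact pow_le_pow_left₀ (norm_nonneg _) hle 2
    rw [norm_smul, norm_smul, Real.norm_natCast]
    norm_num
    linarith
  have hw : ‖block (weightError μ W H * Y) i * y‖ ≤ n * μ / 10 * ‖y‖ := by
    refine (norm_mul_le_opNorm _ _).trans (mul_le_mul_of_nonneg_right ?_ hy)
    rw [← blockCol_transpose_mul (isSymm_weightError μ hW H)]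
    exact hWY i
  have hnh : ‖block (N * H) i * (h * y)‖ ≤ n * μ / 10 * ‖y‖ := by
    refine (norm_mul_le_opNorm _ _).trans ?_
    rw [norm_mul_of_transpose_mul_self hh.1]
    exact mul_le_mul_of_nonneg_right ((opNorm_block_le_blockInfNorm _ i).trans hNH) hy
  have hnx : ‖block (N * X) i * y‖ ≤ n * μ / 900 * ‖y‖ := by
    refine (Matrix.frobenius_norm_mul _ _).trans (mul_le_mul_of_nonneg_right ?_ hy)
    refine (norm_block_le _ i).trans ((norm_mul_le_opNorm _ _).trans (le_trans ?_ hηe))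
    exact mul_le_mul hN hle (norm_nonneg _) hP.η_nonneg
  rw [hsplit]
  have hadd : ∀ A B : Matrix (Fin d) Unit ℝ, ‖A‖ - ‖B‖ ≤ ‖A + B‖ := fun A B => by
    have := norm_sub_norm_le A (-B)
    rwa [norm_neg, sub_neg_eq_add] at this
  refine le_trans ?_ (hadd _ _)
  have hr := (norm_add_le (block (weightError μ W H * Y) i * y)
    (block (N * H) i * (h * y) + block (N * X) i * y)).trans
    (add_le_add_right (norm_add_le _ _) _)
  rw [norm_smul, Real.norm_of_nonneg hP.μ_pos.le]
  have h1 := mul_le_mul_of_nonneg_left hmain hP.μ_pos.le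
  have h2 : μ * (e ^ 2 * ‖y‖) ≤ μ * (n / 225 * ‖y‖) :=
    mul_le_mul_of_nonneg_left (mul_le_mul_of_nonneg_right hP.e_sq hy) hP.μ_pos.le
  have h3 : 0 ≤ n * μ * ‖y‖ := mul_nonneg hP.nμ_pos.le hy
  linarith

end Multipliers

/-! ### Linear convergence of the whole run. -/

section Convergence

open scoped Matrix.Norms.Frobenius

variable {n d : ℕ}

theorem phaseDist_le (X Y : BlockVec n d) {g : Matrix (Fin d) (Fin d) ℝ} (hg : g ∈ orthGroup d) :
    phaseDist X Y ≤ ‖X - Y * g‖ := by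
  rw [← frobNorm_eq_norm]
  exact ciInf_le (f := fun g : orthGroup d => frobNorm (X - Y * (g : Matrix (Fin d) (Fin d) ℝ)))
    ⟨0, by rintro _ ⟨g, rfl⟩; exact Real.sqrt_nonneg _⟩ ⟨g, hg⟩

/-- One step of the power method from a point that is no worse than the initial one. -/
theorem IsPerturbation.gap_step {C R : BlockMat n d} {H : BlockVec n d} {μ η e α : ℝ}
    (hP : IsPerturbation C H R μ η e) (hα : η ≤ α) (hα' : α ≤ n * μ / 30) {Y G : BlockVec n d}
    (hY : IsGlobalMaximizer C Y) (hG : G ∈ orthProd n d)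
    (hκ : ∀ i, (block (C * Y) i * (block Y i)ᵀ - (n * μ * (79 / 100)) • 1).PosSemidef)
    (hf : objective C H - objective C G ≤ n * μ * (5 * e ^ 2)) :
    n * μ / 2 * phaseDist G Y ^ 2 ≤ objective C Y - objective C G ∧
      ∀ G' ∈ projOrthProd ((C + α • (1 : BlockMat n d)) * G),
        objective C Y - objective C G' ≤ (objective C Y - objective C G) * (1 / 2) := by
  obtain ⟨h₁, hh₁, -, hY₁⟩ := hP.exists_dist_le (gram_of_mem_orthProd hY.1) (hY.2 _ hP.mem)
  obtain ⟨h₂, hh₂, hG₂⟩ := hP.exists_dist_le_of_objective_ge hG hf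
  obtain ⟨g, hg, hpsd, hmin⟩ := exists_aligned Y G
  -- Triangle inequality through `H * h₂`: `4e` from `G` and `e` from a rotation of `Y`.
  have hdist : ‖G - Y * g‖ ≤ 5 * e := by
    have hk := mul_mem_orthGroup (transpose_mem_orthGroup hh₁) hh₂
    refine (hmin _ hk).trans ((norm_sub_le_norm_sub_add_norm_sub _ (H * h₂) _).trans ?_)
    have : H * h₂ - Y * (h₁ᵀ * h₂) = -((Y - H * h₁) * (h₁ᵀ * h₂)) := by
      rw [Matrix.sub_mul, Matrix.mul_assoc H, ← Matrix.mul_assoc h₁, hh₁.2, Matrix.one_mul,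
        neg_sub]
    rw [this, norm_neg, norm_mul_of_mul_transpose_self hk.2]
    linarith
  have hYg : ‖Y * g - H * (h₁ * g)‖ ≤ e := by
    rwa [← Matrix.mul_assoc, ← Matrix.sub_mul, norm_mul_of_mul_transpose_self hg.2]
  have hκ' : ∀ i, (block (C * (Y * g)) i * (block (Y * g) i)ᵀ
      - (n * μ * (79 / 100)) • 1).PosSemidef := by
    intro i
    rw [← Matrix.mul_assoc, block_mul, block_mul, Matrix.transpose_mul, Matrix.mul_assoc,
      ← Matrix.mul_assoc g, hg.2, Matrix.one_mul]
    exact hκ i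
  have hc := hP.contraction hα hα' (mul_orth_mem_orthProd hY.1 hg) hG hκ'
    (mul_mem_orthGroup hh₁ hg) hYg hpsd hdist
  rw [objective_mul_orth C Y hg] at hc
  refine ⟨le_trans ?_ hc.1, hc.2⟩
  have h0 : 0 ≤ phaseDist G Y := Real.iInf_nonneg fun _ => Real.sqrt_nonneg _
  have := hP.nμ_pos
  gcongr
  exact phaseDist_le G Y hg

theorem IsPerturbation.linear_convergence {C R : BlockMat n d} {H : BlockVec n d} {μ η e α : ℝ}
    (hP : IsPerturbation C H R μ η e) (hd : 0 < d) (hα : η ≤ α) (hα' : α ≤ n * μ / 30)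
    {Y : BlockVec n d} (hY : IsGlobalMaximizer C Y)
    (hκ : ∀ i, (block (C * Y) i * (block Y i)ᵀ - (n * μ * (79 / 100)) • 1).PosSemidef)
    {G : ℕ → BlockVec n d} (hG : IsGPMRun C α G) (k : ℕ) :
    objective C Y - objective C (G k) ≤ (objective C Y - objective C (G 0)) * (1 / 2) ^ k ∧
      phaseDist (G k) Y ≤ √(2 / (n * μ)) * √(objective C Y - objective C (G 0)) *
        (1 / 2 : ℝ) ^ ((k : ℝ) / 2) := by
  obtain ⟨⟨Φ, hΦ, h0⟩, hstep⟩ := hG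
  -- The invariant is the objective level, preserved by monotonicity; no control of distances
  -- between steps is needed.
  have hinv : ∀ k, G k ∈ orthProd n d ∧
      objective C H - objective C (G k) ≤ n * μ * (5 * e ^ 2) := by
    intro k
    induction k with
    | zero => exact ⟨mem_orthProd_of_mem_projOrthProd h0, hP.initial_gap hd hΦ h0⟩
    | succ k ih =>
      have := hP.objective_mono hα ih.1 (hstep k)
      exact ⟨mem_orthProd_of_mem_projOrthProd (hstep k), by linarith [ih.2]⟩
  have hone : ∀ k, _ := fun k => hP.gap_step hα hα' hY (hinv k).1 hκ (hinv k).2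
  have hgap : ∀ k, objective C Y - objective C (G k) ≤
      (objective C Y - objective C (G 0)) * (1 / 2) ^ k := by
    intro k
    induction k with
    | zero => simp
    | succ k ih =>
      refine ((hone k).2 _ (hstep k)).trans ?_
      rw [pow_succ, ← mul_assoc]
      exact mul_le_mul_of_nonneg_right ih (by norm_num)
  refine ⟨hgap k, ?_⟩
  have hnμ := hP.nμ_pos
  have h1 := (hone k).1.trans (hgap k)
  have hpow : (1 / 2 : ℝ) ^ ((k : ℝ) / 2) = √((1 / 2) ^ k) := by
    rw [Real.sqrt_eq_rpow, ← Real.rpow_natCast, ← Real.rpow_mul (by norm_num)]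
    ring_nf
  have hF : 0 ≤ objective C Y - objective C (G 0) := sub_nonneg.mpr (hY.2 _ (hinv 0).1)
  rw [hpow, ← Real.sqrt_mul (by positivity), ← Real.sqrt_mul (by positivity)]
  refine Real.le_sqrt_of_sq_le ?_
  rw [mul_assoc, div_mul_eq_mul_div, le_div_iff₀ hnμ]
  linarith

end Convergence

/-! ### Numerical consequences of the hypotheses. -/

section Constants

variable {n d : ℕ}

/-- With `r = n^{1/4}`, the exponent `3/4` gives `√(nd) η ≤ r²·r³μ/60 = nμr/60`, which fixes `e =
r/15`; the other bounds use `r ≥ 1` and `d ≥ 1`. -/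
theorem scale_bounds (hn : 0 < n) (hd : 0 < d) {μ η : ℝ} (hμ : 0 < μ) (hη0 : 0 ≤ η)
    (hη : η ≤ (n : ℝ) ^ (3 / 4 : ℝ) * μ / (60 * √d)) :
    √(n * d) * η ≤ n * μ * ((n : ℝ) ^ (1 / 4 : ℝ) / 15) / 4 ∧
      ((n : ℝ) ^ (1 / 4 : ℝ) / 15) ^ 2 ≤ n / 225 ∧ η ≤ n * μ / 60 ∧
      η * ((n : ℝ) ^ (1 / 4 : ℝ) / 15) ≤ n * μ / 900 := by
  have hn1 : (1 : ℝ) ≤ n := by exact_mod_cast hn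
  have hd1 : 1 ≤ √(d : ℝ) := Real.one_le_sqrt.mpr (by exact_mod_cast hd)
  set r := (n : ℝ) ^ (1 / 4 : ℝ) with hr
  have hr1 : 1 ≤ r := Real.one_le_rpow hn1 (by norm_num)
  have hr2 : √(n : ℝ) = r ^ 2 := by
    rw [hr, Real.sqrt_eq_rpow, ← Real.rpow_natCast, ← Real.rpow_mul (by positivity)]
    norm_num
  have hr3 : (n : ℝ) ^ (3 / 4 : ℝ) = r ^ 3 := by
    rw [hr, ← Real.rpow_natCast, ← Real.rpow_mul (by positivity)]
    norm_num
  have hr4 : (n : ℝ) = r ^ 4 := by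
    rw [hr, ← Real.rpow_natCast, ← Real.rpow_mul (by positivity)]
    norm_num
  have hη' : √(d : ℝ) * η ≤ r ^ 3 * μ / 60 := by
    rw [hr3, le_div_iff₀ (by positivity)] at hη
    linarith
  have hη'' : η ≤ r ^ 3 * μ / 60 := (le_mul_of_one_le_left hη0 hd1).trans hη'
  rw [Real.sqrt_mul (by positivity), hr2, hr4]
  refine ⟨?_, ?_, ?_, ?_⟩
  · have := mul_le_mul_of_nonneg_left hη' (by positivity : 0 ≤ r ^ 2)
    nlinarith
  · have : r ^ 2 ≤ r ^ 4 := pow_le_pow_right₀ hr1 (by norm_num)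
    linarith
  · have : r ^ 3 * μ ≤ r ^ 4 * μ :=
      mul_le_mul_of_nonneg_right (pow_le_pow_right₀ hr1 (by norm_num)) hμ.le
    linarith
  · have := mul_le_mul_of_nonneg_right hη'' (by positivity : 0 ≤ r / 15)
    linarith

theorem stepsize_le (hd : 0 < d) {μ α : ℝ} (hμ : 0 < μ)
    (hα : α ≤ n * μ / (30 * √(2 * d))) : α ≤ n * μ / 30 := by
  refine hα.trans ?_
  have hd1 : 1 ≤ √(2 * d : ℝ) := by
    have : (1 : ℝ) ≤ d := by exact_mod_cast hd
    exact Real.one_le_sqrt.mpr (by linarith)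
  gcongr
  linarith

end Constants

/-! ### The model as a perturbation of the rank-`d` signal. -/

section Assembly

open scoped Matrix.Norms.Frobenius

variable {n d : ℕ}

theorem isPerturbation_measurement (hn : 0 < n) (hd : 0 < d) {μ : ℝ} (hμ : 0 < μ)
    {W : Matrix (Fin n) (Fin n) ℝ} (hW : W.IsSymm) {H : BlockVec n d} (hH : H ∈ orthProd n d)
    {Δ : BlockMat n d} (hΔ : Δ.IsSymm)
    (hη : opNorm (W - μ • ones (Fin n)) + opNorm (adjBlock d W ⊙ Δ)
      ≤ (n : ℝ) ^ (3 / 4 : ℝ) * μ / (60 * √d)) :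
    IsPerturbation (measurement W H Δ) H (weightError μ W H + adjBlock d W ⊙ Δ) μ
      (opNorm (W - μ • ones (Fin n)) + opNorm (adjBlock d W ⊙ Δ))
      ((n : ℝ) ^ (1 / 4 : ℝ) / 15) := by
  have h0 : 0 ≤ opNorm (W - μ • ones (Fin n)) + opNorm (adjBlock d W ⊙ Δ) :=
    add_nonneg (norm_nonneg _) (norm_nonneg _)
  obtain ⟨h1, h2, h3, -⟩ := scale_bounds hn hd hμ h0 hη
  exact
    { eq := measurement_eq μ W H Δ
      symm := (isSymm_weightError μ hW H).add (isSymm_adjBlock_hadamard hW hΔ)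
      bound := fun X Y => by
        rw [Matrix.add_mul, Matrix.mul_add, Matrix.trace_add, add_mul, add_mul]
        exact (abs_add_le _ _).trans
          (add_le_add (abs_trace_weightError_le μ W hH X Y) (abs_trace_le_opNorm _ X Y))
      mem := hH
      n_pos := hn
      μ_pos := hμ
      η_nonneg := h0
      e_nonneg := by positivity
      sqrt_mul_η := h1
      e_sq := h2
      η_le := h3 }

end Assembly

end OrthSync

theorem theorem5p1 (n d : ℕ) (hn : 0 < n) (hd : 0 < d) (μ α : ℝ) (hμ : 0 < μ) :
    ∃ a lam : ℝ, 0 < a ∧ 0 < lam ∧ lam < 1 ∧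
      ∀ (W : Matrix (Fin n) (Fin n) ℝ) (Gstar : BlockVec n d) (Δ : BlockMat n d)
        (Ghat : BlockVec n d) (G : ℕ → BlockVec n d),
        W.IsSymm → (∀ i, W i i = μ) →
        Gstar ∈ orthProd n d →
        IsNoise Δ →
        IsGlobalMaximizer (measurement W Gstar Δ) Ghat →
        -- (i)
        opNorm (W - μ • ones (Fin n)) + opNorm (adjBlock d W ⊙ Δ)
          ≤ (n : ℝ) ^ (3 / 4 : ℝ) * μ / (60 * Real.sqrt d) →
        blockInfNorm ((adjBlock d W ⊙ Δ) * Gstar) ≤ n * μ / 10 →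
        -- (ii)
        (∀ i : Fin n,
          opNorm ((blockCol ((adjBlock d W - μ • ones (Fin n × Fin d)) ⊙ (Gstar * Gstarᵀ)) i)ᵀ
            * Ghat) ≤ n * μ / 10) →
        -- (iii)
        opNorm (adjBlock d W ⊙ Δ) + opNorm (W - μ • ones (Fin n)) < α →
        α ≤ n * μ / (30 * Real.sqrt (2 * d)) →
        IsGPMRun (measurement W Gstar Δ) α G →
        ∀ k : ℕ,
          objective (measurement W Gstar Δ) Ghat - objective (measurement W Gstar Δ) (G k)
            ≤ (objective (measurement W Gstar Δ) Ghat
                - objective (measurement W Gstar Δ) (G 0)) * lam ^ k ∧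
          phaseDist (G k) Ghat
            ≤ a * Real.sqrt (objective (measurement W Gstar Δ) Ghat
                - objective (measurement W Gstar Δ) (G 0)) * lam ^ ((k : ℝ) / 2) := by
  have hnμ : 0 < n * μ := mul_pos (by exact_mod_cast hn) hμ
  -- The constant `a` inverts the bound of the gap below by `(nμ/2)` times the squared distance.
  refine ⟨√(2 / (n * μ)), 1 / 2, by positivity, by norm_num, by norm_num, ?_⟩
  intro W Gstar Δ Ghat G hW hWμ hGstar hΔ hGhat h1 h2 h3 h4 h5 hG k
  have hP := isPerturbation_measurement hn hd hμ hW hGstar hΔ.1 h1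
  have hκ := posSemidef_multiplier_sub hW hWμ hΔ hP (le_add_of_nonneg_left (norm_nonneg _))
    (scale_bounds hn hd hμ hP.η_nonneg h1).2.2.2 h2 hGhat h3
  exact hP.linear_convergence hd (by linarith) (stepsize_le hd hμ h5) hGhat hκ hG k
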